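/- Let $\mathbb{T}$ be the unit circle and $\mathbb{D}$ the open unit disc. A closed set $E\subset\mathbb{T}$ is a Beurling–Carleson set if it has Lebesgue measure zero and $\sum_n |I_n|\log\frac{1}{|I_n|}<\infty$, where $\mathbb{T}\setminus E$ is the disjoint union of the open arcs $I_n$ and $|\cdot|$ denotes Lebesgue measure. For a finite positive Borel measure $\mu$ on $\mathbb{T}$ let $\hat\mu(n)=\int_{\mathbb{T}} e^{-in\theta}\,d\mu(\theta)$ for $n\in\mathbb{Z}$, and $$S_\mu(z)=\exp\Big\{-\int_{\mathbb{T}}\frac{e^{i\theta}+z}{e^{i\theta}-z}\,d\mu(\theta)\Big\},\qquad z\in\mathbb{D}.$$ For $p>2$ let $\ell^p_A$ be the space of holomorphic functions $f$ on $\mathbb{D}$ whose Maclaurin coefficients $\hat f(k)$ satisfy $\|f\|_p^p=\sum_{k\ge 0}|\hat f(k)|^p<\infty$. A function $f\in\ell^p_A$ is cyclic in $\ell^p_A$ if there are polynomials $P_n$ such that $\|P_nf-1\|_p\to 0$. **Theorem.** For every real $p>2$ there exists a nonzero finite positive Borel measure $\mu$ on $\mathbb{T}$, singular with respect to Lebesgue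 measure, such that $\mu(\mathbb{T}\setminus E)=0$ for some Beurling–Carleson set $E$, and $\sum_{n\in\mathbb{Z}}|\hat\mu(n)|^p<\infty$. Moreover, for this measure, $\log S_\mu\in\ell^p_A$ (that is, $S_\mu$ has a holomorphic logarithm on $\mathbb{D}$, and every such logarithm lies in $\ell^p_A$), and $S_\mu\in\ell^p_A$, but $S_\mu$ is not cyclic in $\ell^p_A$. -/

import Mathlib

open MeasureTheory Filter Topology
open scoped ENNReal Real

/-- Positivity of the period, needed for the Lebesgue measure on `ℝ / 2πℤ`. -/
instance instFactTwoPiPos : Fact (0 < 2 * π) := ⟨Real.two_pi_pos⟩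

/-- The unit circle `𝕋`, parametrized by the angle `θ ∈ ℝ / 2πℤ`; the point `e^{iθ}` is
`AddCircle.toCircle θ` and `volume` is Lebesgue (arc length) measure, of total mass `2π`. -/
abbrev UnitCircle : Type := AddCircle (2 * π)

/-- A Beurling–Carleson set: a closed set `E ⊆ 𝕋` of Lebesgue measure zero such that `𝕋 \ E` is
the disjoint union of open arcs `I n` with `∑ |I n| log (1 / |I n|) < ∞`. The arcs are indexed
by `ℕ`; if there are only finitely many, the remaining `I n` are empty and contribute `0`. The open
connected subsets of `𝕋` are the open arcs and `𝕋` itself (needed when `E` is empty). -/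
def IsBeurlingCarleson (E : Set UnitCircle) : Prop :=
  IsClosed E ∧ volume E = 0 ∧
    ∃ I : ℕ → Set UnitCircle,
      (∀ n, IsOpen (I n) ∧ IsPreconnected (I n)) ∧
      Pairwise (fun m n => Disjoint (I m) (I n)) ∧
      (⋃ n, I n) = Eᶜ ∧
      Summable fun n => volume.real (I n) * Real.log (1 / volume.real (I n))

/-- The Fourier coefficient `∫ e^{-inθ} dμ(θ)` of a measure on the circle. -/
noncomputable def measureFourierCoeff (μ : Measure UnitCircle) (n : ℤ) : ℂ :=
  ∫ θ, fourier (-n) θ ∂μ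

/-- `S_μ(z) = exp (- ∫ (e^{iθ} + z) / (e^{iθ} - z) dμ(θ))`, of interest for `|z| < 1`. -/
noncomputable def singularInner (μ : Measure UnitCircle) (z : ℂ) : ℂ :=
  Complex.exp (-∫ θ, ((θ.toCircle : ℂ) + z) / ((θ.toCircle : ℂ) - z) ∂μ)

/-- The Maclaurin coefficient of order `k`. -/
noncomputable def maclaurinCoeff (f : ℂ → ℂ) (k : ℕ) : ℂ :=
  iteratedDeriv k f 0 / (k.factorial : ℂ)

/-- The `ℓ^p_A` norm `(∑ |f̂(k)|^p)^{1/p}`, with value `∞` when the series diverges. -/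
noncomputable def ellpNorm (p : ℝ) (f : ℂ → ℂ) : ℝ≥0∞ :=
  (∑' k : ℕ, ‖maclaurinCoeff f k‖ₑ ^ p) ^ (1 / p)

/-- `f` (restricted to the open unit disc) belongs to `ℓ^p_A`. -/
def MemEllpA (p : ℝ) (f : ℂ → ℂ) : Prop :=
  DifferentiableOn ℂ f (Metric.ball 0 1) ∧ ellpNorm p f < ∞

/-- `f ∈ ℓ^p_A` is cyclic: there are polynomials `P n` with `‖P n * f - 1‖ → 0` in `ℓ^p_A`. -/
def IsCyclicEllpA (p : ℝ) (f : ℂ → ℂ) : Prop :=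
  MemEllpA p f ∧
    ∃ P : ℕ → Polynomial ℂ,
      Tendsto (fun n => ellpNorm p fun z => (P n).eval z * f z - 1) atTop (𝓝 0)

/-- `g` is a holomorphic branch of `log f` on the open unit disc. -/
def IsHolomorphicLog (g f : ℂ → ℂ) : Prop :=
  DifferentiableOn ℂ g (Metric.ball 0 1) ∧ ∀ z ∈ Metric.ball (0 : ℂ) 1, Complex.exp (g z) = f z

/-! The measure `μ` is the law of a random Cantor series whose `i`-th digit is uniform on `i + 1`
values in base `i + 5`, and `E` is its range. With `N_J = cantorDenom J`, two facts are balanced. On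
one hand `J! / N_J` decays like `J⁻⁴`, so the `2⁻ᵏ`-neighbourhoods of `E` have summable lengths
(`summable_thickening_cantorSetCircle`); this alone gives the Beurling–Carleson condition and
non-cyclicity. On the other hand the proportion of cells kept tends to `1`, so `μ̂` is small: its
modulus is at most a product of digit means, and orthogonality on `ℤ/(i+5)` together with a
convexity inequality (`sum_rpow_le_one_add_rpow`) bounds `∑ |μ̂(n)|^p` over `n ≥ 0` by `∏ (1 +
(4/(i+1))^(p/2))`, which converges for `p > 2`.

The Herglotz transform `H` of `μ` satisfies `S = exp (-H)`, so the coefficients of any `log S` of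
order `k ≥ 1` are `-2 μ̂(k)`; and `S` is bounded, so its coefficients lie in `ℓ² ⊆ ℓ^p`.

Non-cyclicity is proved by duality. Measures `ν` outside the disc, clustering at `E`, give bounded
holomorphic functions `exp (-H_ν)` that vanish to second order on `E`. Hence `φ = z^m exp (-H_ν) /
S` has a bounded derivative along the circle and absolutely summable Fourier coefficients, and
pairing with `φ` is continuous for uniform convergence of Maclaurin coefficients. If `P_n S → 1`,
then `∫ P_n S φ → ∫ φ`, while each `P_n S φ = P_n z^m exp (-H_ν)` has mean `0` for `m ≥ 1`; so `∫ φ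
= 0` (`integral_eq_zero_of_cyclic`). Letting the mass of `ν` tend to `0` yields `∫ z^m conj S = 0`
for all `m ≥ 1`, so `S` is constant. This contradicts `|S| = 1` on the circle and `|S(0)| = exp
(-μ(𝕋)) < 1`. -/

open AddCircle

/-! ### Maclaurin coefficients, Parseval's identity and `ℓ^p_A` norms. -/

theorem hasSum_maclaurinCoeff {h : ℂ → ℂ} (hh : DifferentiableOn ℂ h (Metric.ball 0 1)) {z : ℂ}
    (hz : ‖z‖ < 1) : HasSum (fun k => maclaurinCoeff h k * z ^ k) (h z) := by
  have := Complex.hasSum_taylorSeries_on_ball (c := 0) (r := 1) hh (z := z) (by simpa using hz)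
  simpa [maclaurinCoeff, div_eq_mul_inv, mul_comm, mul_left_comm, mul_assoc] using this

theorem maclaurinCoeff_eq_of_hasSum {h : ℂ → ℂ} {a : ℕ → ℂ}
    (hh : ∀ z : ℂ, ‖z‖ < 1 → HasSum (fun k => a k * z ^ k) (h z)) (k : ℕ) :
    maclaurinCoeff h k = a k := by
  have h1 : HasFPowerSeriesAt h (FormalMultilinearSeries.ofScalars ℂ a) 0 := by
    rw [hasFPowerSeriesAt_iff]
    filter_upwards [Metric.ball_mem_nhds (0 : ℂ) one_pos] with z hz
    have := hh z (by simpa using hz)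
    simpa [mul_comm] using this
  have h2 := h1.analyticAt.hasFPowerSeriesAt
  have h3 := congrArg (fun p => FormalMultilinearSeries.coeff p k)
    (h1.eq_formalMultilinearSeries h2)
  simpa [maclaurinCoeff] using h3.symm

@[simp]
theorem norm_toCircle (θ : UnitCircle) : ‖(θ.toCircle : ℂ)‖ = 1 := Circle.norm_coe _

theorem continuous_coe_toCircle : Continuous fun θ : UnitCircle => (θ.toCircle : ℂ) :=
  continuous_subtype_val.comp AddCircle.continuous_toCircle

theorem summable_norm_maclaurinCoeff_mul_pow {h : ℂ → ℂ}
    (hh : DifferentiableOn ℂ h (Metric.ball 0 1)) {r : ℝ} (hr : 0 ≤ r) (hr1 : r < 1) :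
    Summable fun k => ‖maclaurinCoeff h k‖ * r ^ k := by
  have := (hasSum_maclaurinCoeff hh (z := r) (by simpa [abs_of_nonneg hr] using hr1)).summable.norm
  simpa [abs_of_nonneg hr] using this

/-- Used with three kinds of `ψ`: conjugate monomials extract coefficients, the conjugate of `h`
gives Parseval, and the test function `φ` gives the duality estimate. -/
theorem hasSum_integral_mul {h : ℂ → ℂ} (hh : DifferentiableOn ℂ h (Metric.ball 0 1))
    {ψ : UnitCircle → ℂ} (hψ : Integrable ψ haarAddCircle) {r : ℝ} (hr : 0 ≤ r) (hr1 : r < 1) :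
    HasSum (fun k => maclaurinCoeff h k * r ^ k *
        ∫ θ : UnitCircle, (θ.toCircle : ℂ) ^ k * ψ θ ∂haarAddCircle)
      (∫ θ : UnitCircle, h (r * θ.toCircle) * ψ θ ∂haarAddCircle) := by
  have hs := summable_norm_maclaurinCoeff_mul_pow hh hr hr1
  have hint : ∀ k : ℕ, Integrable
      (fun θ : UnitCircle => maclaurinCoeff h k * r ^ k * ((θ.toCircle : ℂ) ^ k * ψ θ))
      haarAddCircle := fun k => by
    refine (hψ.bdd_mul (c := 1) (continuous_coe_toCircle.pow k).aestronglyMeasurable ?_).const_mul _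
    exact ae_of_all _ fun θ => by simp
  have key := hasSum_integral_of_summable_integral_norm hint ?_
  · simp_rw [integral_const_mul] at key
    rwa [integral_congr_ae (ae_of_all _ fun θ => ?_)] at key
    have := (hasSum_maclaurinCoeff hh (z := r * θ.toCircle)
      (by simpa [abs_of_nonneg hr] using hr1)).mul_right (ψ θ)
    rw [← this.tsum_eq]
    exact tsum_congr fun k => by ring
  · simp_rw [norm_mul, integral_const_mul]
    simpa [abs_of_nonneg hr] using hs.mul_right _

theorem integral_fourier (n : ℤ) :
    ∫ θ : UnitCircle, fourier n θ ∂haarAddCircle = if n = 0 then 1 else 0 := by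
  have := orthonormal_iff_ite.1 (orthonormal_fourier (T := 2 * π)) 0 n
  rw [show fourierLp 2 0 = (ContinuousMap.toLp 2 haarAddCircle ℂ (fourier (T := 2 * π) 0)) from rfl,
    show fourierLp 2 n = (ContinuousMap.toLp 2 haarAddCircle ℂ (fourier (T := 2 * π) n)) from rfl,
    ContinuousMap.inner_toLp] at this
  simpa [eq_comm] using this

theorem integral_toCircle_pow_mul_conj_pow (k j : ℕ) :
    ∫ θ : UnitCircle, (θ.toCircle : ℂ) ^ k * (starRingEnd ℂ) ((θ.toCircle : ℂ) ^ j) ∂haarAddCircle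
      = if k = j then 1 else 0 := by
  have h := integral_fourier ((k : ℤ) + (-(j : ℤ)))
  have e : ∀ (n : ℕ) (θ : UnitCircle), fourier (n : ℤ) θ = (θ.toCircle : ℂ) ^ n := fun n θ => by
    rw [fourier_apply, natCast_zsmul, AddCircle.toCircle_nsmul, Circle.coe_pow]
  simp_rw [fourier_add, fourier_neg, e] at h
  rw [h]
  simp only [← sub_eq_add_neg, sub_eq_zero, Nat.cast_inj]

theorem integral_mul_conj_pow {h : ℂ → ℂ} (hh : DifferentiableOn ℂ h (Metric.ball 0 1))
    {r : ℝ} (hr : 0 ≤ r) (hr1 : r < 1) (j : ℕ) :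
    ∫ θ : UnitCircle, h (r * θ.toCircle) * (starRingEnd ℂ) ((θ.toCircle : ℂ) ^ j) ∂haarAddCircle
      = maclaurinCoeff h j * r ^ j := by
  have hc : Continuous fun θ : UnitCircle => (starRingEnd ℂ) ((θ.toCircle : ℂ) ^ j) :=
    Complex.continuous_conj.comp (continuous_coe_toCircle.pow j)
  have := hasSum_integral_mul hh
    (hc.integrable_of_hasCompactSupport (HasCompactSupport.of_compactSpace _)) hr hr1
  simp_rw [integral_toCircle_pow_mul_conj_pow] at this
  refine this.unique ?_
  convert hasSum_ite_eq j (maclaurinCoeff h j * (r : ℂ) ^ j) using 2 with k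
  split_ifs with hk <;> simp [hk]

theorem continuous_comp_circle {h : ℂ → ℂ} (hh : DifferentiableOn ℂ h (Metric.ball 0 1))
    {r : ℝ} (hr : 0 ≤ r) (hr1 : r < 1) :
    Continuous fun θ : UnitCircle => h (r * θ.toCircle) := by
  refine hh.continuousOn.comp_continuous (continuous_const.mul continuous_coe_toCircle) fun θ => ?_
  simpa [abs_of_nonneg hr] using hr1

theorem hasSum_sq_norm_maclaurinCoeff {h : ℂ → ℂ} (hh : DifferentiableOn ℂ h (Metric.ball 0 1))
    {r : ℝ} (hr : 0 ≤ r) (hr1 : r < 1) :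
    HasSum (fun k => ‖maclaurinCoeff h k‖ ^ 2 * (r ^ 2) ^ k)
      (∫ θ : UnitCircle, ‖h (r * θ.toCircle)‖ ^ 2 ∂haarAddCircle) := by
  have hc : Continuous fun θ : UnitCircle => (starRingEnd ℂ) (h (r * θ.toCircle)) :=
    Complex.continuous_conj.comp (continuous_comp_circle hh hr hr1)
  have h1 := hasSum_integral_mul hh
    (hc.integrable_of_hasCompactSupport (HasCompactSupport.of_compactSpace _)) hr hr1
  have h2 : ∀ k : ℕ, ∫ θ : UnitCircle, (θ.toCircle : ℂ) ^ k * (starRingEnd ℂ) (h (r * θ.toCircle))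
      ∂haarAddCircle = (starRingEnd ℂ) (maclaurinCoeff h k * r ^ k) := fun k => by
    rw [← integral_mul_conj_pow hh hr hr1, ← integral_conj]
    simp [mul_comm]
  simp_rw [h2, Complex.mul_conj, Complex.normSq_eq_norm_sq] at h1
  rw [integral_complex_ofReal] at h1
  have h3 := Complex.hasSum_ofReal.1 h1
  convert h3 using 2 with k
  rw [norm_mul, norm_pow, Complex.norm_real, Real.norm_of_nonneg hr]; ring

/-- Parseval on the circle of radius `r` bounds every partial sum by `C ^ 2`; then `r → 1`. -/
theorem summable_sq_norm_maclaurinCoeff {h : ℂ → ℂ} (hh : DifferentiableOn ℂ h (Metric.ball 0 1))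
    {C : ℝ} (hC : ∀ z : ℂ, ‖z‖ < 1 → ‖h z‖ ≤ C) :
    Summable fun k => ‖maclaurinCoeff h k‖ ^ 2 := by
  refine summable_of_sum_range_le (c := C ^ 2) (fun _ => by positivity) fun n => ?_
  have hlim : Tendsto (fun r : ℝ => ∑ k ∈ Finset.range n, ‖maclaurinCoeff h k‖ ^ 2 * (r ^ 2) ^ k)
      (𝓝[<] 1) (𝓝 (∑ k ∈ Finset.range n, ‖maclaurinCoeff h k‖ ^ 2 * ((1 : ℝ) ^ 2) ^ k)) :=
    (Continuous.tendsto (by fun_prop) 1).mono_left nhdsWithin_le_nhds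
  simp only [one_pow, mul_one] at hlim
  refine le_of_tendsto hlim ?_
  filter_upwards [Ioo_mem_nhdsLT (show (0 : ℝ) < 1 by norm_num)] with r hr
  have h1 := hasSum_sq_norm_maclaurinCoeff hh hr.1.le hr.2
  refine (h1.summable.sum_le_tsum _ fun _ _ => by positivity).trans ?_
  rw [h1.tsum_eq]
  have hb : ∀ θ : UnitCircle, ‖h (r * θ.toCircle)‖ ^ 2 ≤ C ^ 2 := fun θ => by
    gcongr
    exact hC _ (by simpa [abs_of_pos hr.1] using hr.2)
  refine (integral_mono_of_nonneg (ae_of_all _ fun _ => by positivity) (integrable_const (C ^ 2))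
    (ae_of_all _ hb)).trans ?_
  simp

theorem ellpNorm_lt_top_of_summable {p : ℝ} (hp : 0 < p) {f : ℂ → ℂ}
    (h : Summable fun k => ‖maclaurinCoeff f k‖ ^ p) : ellpNorm p f < ∞ := by
  refine ENNReal.rpow_lt_top_of_nonneg (by positivity) ?_
  have : ∀ k, ‖maclaurinCoeff f k‖ₑ ^ p = ENNReal.ofReal (‖maclaurinCoeff f k‖ ^ p) := fun k => by
    rw [← ofReal_norm, ENNReal.ofReal_rpow_of_nonneg (norm_nonneg _) hp.le]
  simp_rw [this]
  exact h.tsum_ofReal_ne_top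

/-- The duality argument uses `ℓ^p` convergence only through the supremum of the coefficients. -/
theorem enorm_maclaurinCoeff_le_ellpNorm {p : ℝ} (hp : 0 < p) (f : ℂ → ℂ) (k : ℕ) :
    ‖maclaurinCoeff f k‖ₑ ≤ ellpNorm p f := by
  have := ENNReal.le_tsum (f := fun k => ‖maclaurinCoeff f k‖ₑ ^ p) k
  calc ‖maclaurinCoeff f k‖ₑ = (‖maclaurinCoeff f k‖ₑ ^ p) ^ (1 / p) := by
        rw [← ENNReal.rpow_mul, mul_one_div_cancel hp.ne', ENNReal.rpow_one]
    _ ≤ _ := ENNReal.rpow_le_rpow this (by positivity)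

theorem summable_rpow_norm_maclaurinCoeff {h : ℂ → ℂ}
    (hh : DifferentiableOn ℂ h (Metric.ball 0 1)) {C : ℝ} (hC : ∀ z : ℂ, ‖z‖ < 1 → ‖h z‖ ≤ C)
    {p : ℝ} (hp : 2 ≤ p) : Summable fun k => ‖maclaurinCoeff h k‖ ^ p := by
  have h2 := summable_sq_norm_maclaurinCoeff hh hC
  refine h2.of_norm_bounded_eventually_nat ?_
  have : ∀ᶠ k in atTop, ‖maclaurinCoeff h k‖ ^ 2 < 1 := h2.tendsto_atTop_zero.eventually_lt_const one_pos
  filter_upwards [this] with k hk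
  rw [Real.norm_of_nonneg (by positivity), ← Real.rpow_natCast]
  exact Real.rpow_le_rpow_of_exponent_ge_of_imp (norm_nonneg _)
    (by nlinarith [norm_nonneg (maclaurinCoeff h k)]) (by simpa using hp) (by intro _ h; linarith)

/-! ### Herglotz transforms of measures clustering at `K`, up to the boundary. -/

/-- The Herglotz transform of a measure on the complex plane. -/
noncomputable def herglotz (ν : Measure ℂ) (z : ℂ) : ℂ := ∫ w, (w + z) / (w - z) ∂ν

/-- A measure carried by the annulus `1 ≤ |w| ≤ 2`, whose mass stays away from the points of the
closed unit disc, in proportion to the distance of these points from `K`. -/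
def CarriedNear (ν : Measure ℂ) (K : Set ℂ) : Prop :=
  ∀ᵐ w ∂ν, 1 ≤ ‖w‖ ∧ ‖w‖ ≤ 2 ∧ ∀ z : ℂ, ‖z‖ ≤ 1 → Metric.infDist z K ≤ 3 * ‖w - z‖

section Herglotz

variable {ν : Measure ℂ} {K : Set ℂ}

theorem aestronglyMeasurable_herglotz_kernel (z : ℂ) :
    AEStronglyMeasurable (fun w : ℂ => (w + z) / (w - z)) ν :=
  Measurable.aestronglyMeasurable (by fun_prop)

theorem CarriedNear.norm_kernel_le (hν : CarriedNear ν K) {z : ℂ} (hz : ‖z‖ ≤ 1)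
    (hρ : 0 < Metric.infDist z K) :
    ∀ᵐ w ∂ν, ‖(w + z) / (w - z)‖ ≤ 9 / Metric.infDist z K := by
  filter_upwards [hν] with w hw
  have h1 := hw.2.2 z hz
  have h2 : ‖w + z‖ ≤ 3 := (norm_add_le _ _).trans (by linarith [hw.2.1])
  have h3 : 0 < ‖w - z‖ := by linarith
  rw [norm_div, div_le_div_iff₀ h3 hρ]
  nlinarith

theorem CarriedNear.integrable_kernel [IsFiniteMeasure ν] (hν : CarriedNear ν K) {z : ℂ}
    (hz : ‖z‖ ≤ 1) (hρ : 0 < Metric.infDist z K) :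
    Integrable (fun w : ℂ => (w + z) / (w - z)) ν :=
  Integrable.of_bound (aestronglyMeasurable_herglotz_kernel z) _ (hν.norm_kernel_le hz hρ)

theorem CarriedNear.norm_herglotz_le [IsFiniteMeasure ν] (hν : CarriedNear ν K) {z : ℂ}
    (hz : ‖z‖ ≤ 1) (hρ : 0 < Metric.infDist z K) :
    ‖herglotz ν z‖ ≤ 9 / Metric.infDist z K * ν.real Set.univ :=
  norm_integral_le_of_norm_le_const (hν.norm_kernel_le hz hρ)

/-- Boundary points off `K` are included: no mass lies within `ρ / 3` of `z`, so the kernel stays at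
distance `ρ / 6` from its pole when `z` moves by less than `ρ / 6`. -/
theorem CarriedNear.hasDerivAt_herglotz [IsFiniteMeasure ν] (hν : CarriedNear ν K) {z : ℂ}
    (hz : ‖z‖ ≤ 1) (hρ : 0 < Metric.infDist z K) :
    HasDerivAt (herglotz ν) (∫ w, 2 * w / (w - z) ^ 2 ∂ν) z := by
  set ρ := Metric.infDist z K
  have hlow : ∀ᵐ w ∂ν, ‖w‖ ≤ 2 ∧ ∀ x ∈ Metric.ball z (ρ / 6), ρ / 6 ≤ ‖w - x‖ := by
    filter_upwards [hν] with w hw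
    refine ⟨hw.2.1, fun x hx => ?_⟩
    have h1 := hw.2.2 z hz
    have h2 : ‖w - z‖ ≤ ‖w - x‖ + ‖x - z‖ := norm_sub_le_norm_sub_add_norm_sub _ _ _
    rw [Metric.mem_ball, dist_eq_norm] at hx
    linarith
  refine (hasDerivAt_integral_of_dominated_loc_of_deriv_le (F := fun x w => (w + x) / (w - x))
    (F' := fun x w => 2 * w / (w - x) ^ 2) (bound := fun _ => 4 / (ρ / 6) ^ 2)
    (Metric.ball_mem_nhds z (by positivity : 0 < ρ / 6))
    (Eventually.of_forall fun x => aestronglyMeasurable_herglotz_kernel x)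
    (hν.integrable_kernel hz hρ) (Measurable.aestronglyMeasurable (by fun_prop)) ?_
    (integrable_const _) ?_).2
  · filter_upwards [hlow] with w hw x hx
    have := hw.2 x hx
    rw [norm_div, norm_mul, norm_pow]
    have h2 : ‖(2 : ℂ)‖ * ‖w‖ ≤ 4 := by rw [Complex.norm_ofNat]; linarith [hw.1]
    gcongr
  · filter_upwards [hlow] with w hw x hx
    have h0 : w - x ≠ 0 := norm_pos_iff.1 (lt_of_lt_of_le (by positivity) (hw.2 x hx))
    convert! ((hasDerivAt_id x).const_add w).div ((hasDerivAt_id x).const_sub w) h0 using 1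
    simp only [id]; ring

theorem CarriedNear.norm_deriv_herglotz_le [IsFiniteMeasure ν] (hν : CarriedNear ν K) {z : ℂ}
    (hz : ‖z‖ ≤ 1) (hρ : 0 < Metric.infDist z K) :
    ‖∫ w, 2 * w / (w - z) ^ 2 ∂ν‖ ≤ 36 / Metric.infDist z K ^ 2 * ν.real Set.univ := by
  refine norm_integral_le_of_norm_le_const ?_
  filter_upwards [hν] with w hw
  have h1 := hw.2.2 z hz
  have h2 : ‖2 * w‖ ≤ 4 := by rw [norm_mul, Complex.norm_ofNat]; linarith [hw.2.1]
  have h3 : 0 < ‖w - z‖ := by linarith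
  rw [norm_div, norm_pow, div_le_div_iff₀ (by positivity) (by positivity)]
  have : Metric.infDist z K ^ 2 ≤ 9 * ‖w - z‖ ^ 2 := by nlinarith
  nlinarith [sq_nonneg ‖w - z‖]

theorem re_herglotz_kernel (w z : ℂ) :
    ((w + z) / (w - z)).re = (‖w‖ ^ 2 - ‖z‖ ^ 2) / ‖w - z‖ ^ 2 := by
  rw [Complex.div_re, ← Complex.normSq_eq_norm_sq, ← Complex.normSq_eq_norm_sq,
    ← Complex.normSq_eq_norm_sq, ← add_div]
  congr 1
  simp [Complex.normSq_apply]; ring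

/-- The real part of the kernel is of Poisson type, with numerator `‖w‖² - ‖z‖² ≥ 0`. -/
theorem re_herglotz_nonneg (hν : CarriedNear ν K) {z : ℂ} (hz : ‖z‖ ≤ 1) :
    0 ≤ (herglotz ν z).re := by
  by_cases hi : Integrable (fun w : ℂ => (w + z) / (w - z)) ν
  · rw [herglotz, ← RCLike.re_eq_complex_re, ← integral_re hi]
    refine integral_nonneg_of_ae ?_
    filter_upwards [hν] with w hw
    rw [RCLike.re_eq_complex_re, re_herglotz_kernel]
    have : ‖z‖ ^ 2 ≤ ‖w‖ ^ 2 := by gcongr; linarith [hw.1]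
    exact div_nonneg (by linarith) (by positivity)
  -- A non-integrable kernel has integral `0` by convention.
  · simp [herglotz, integral_undef hi]

/-- The numerator `‖w‖² - ‖z‖²` vanishes. Thus `|S| = 1` at every boundary point, the default values
on `K` included. -/
theorem re_herglotz_eq_zero (hν : ∀ᵐ w ∂ν, ‖w‖ = 1) {z : ℂ} (hz : ‖z‖ = 1) :
    (herglotz ν z).re = 0 := by
  by_cases hi : Integrable (fun w : ℂ => (w + z) / (w - z)) ν
  · rw [herglotz, ← RCLike.re_eq_complex_re, ← integral_re hi]
    refine integral_eq_zero_of_ae ?_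
    filter_upwards [hν] with w hw
    rw [RCLike.re_eq_complex_re, re_herglotz_kernel, hw, hz]
    simp
  · simp [herglotz, integral_undef hi]

theorem norm_exp_neg_herglotz_le_one (hν : CarriedNear ν K) {z : ℂ} (hz : ‖z‖ ≤ 1) :
    ‖Complex.exp (-herglotz ν z)‖ ≤ 1 := by
  rw [Complex.norm_exp, Complex.neg_re]
  exact Real.exp_le_one_iff.2 (by linarith [re_herglotz_nonneg hν hz])

theorem infDist_pos_of_norm_lt_one (hK : IsClosed K) (hK0 : K.Nonempty)
    (hK1 : K ⊆ Metric.sphere 0 1) {z : ℂ} (hz : ‖z‖ < 1) : 0 < Metric.infDist z K :=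
  (hK.notMem_iff_infDist_pos hK0).1 fun h => by
    have := hK1 h
    simp at this; linarith

theorem CarriedNear.differentiableOn_herglotz [IsFiniteMeasure ν] (hν : CarriedNear ν K)
    (hK : IsClosed K) (hK0 : K.Nonempty) (hK1 : K ⊆ Metric.sphere 0 1) :
    DifferentiableOn ℂ (herglotz ν) (Metric.ball 0 1) := fun z hz => by
  have hz : ‖z‖ < 1 := by simpa using hz
  exact (hν.hasDerivAt_herglotz hz.le
    (infDist_pos_of_norm_lt_one hK hK0 hK1 hz)).differentiableAt.differentiableWithinAt

end Herglotz

/-! ### Radial limits, and Fourier coefficients of functions with bounded derivative. -/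

theorem tendsto_integral_radial {h : ℂ → ℂ} (hh : DifferentiableOn ℂ h (Metric.ball 0 1))
    {C : ℝ} (hC : ∀ z : ℂ, ‖z‖ < 1 → ‖h z‖ ≤ C)
    (hb : ∀ᵐ θ : UnitCircle ∂haarAddCircle, ContinuousAt h θ.toCircle)
    {ψ : UnitCircle → ℂ} (hψ : Integrable ψ haarAddCircle) :
    Tendsto (fun r : ℝ => ∫ θ : UnitCircle, h (r * θ.toCircle) * ψ θ ∂haarAddCircle) (𝓝[<] 1)
      (𝓝 (∫ θ : UnitCircle, h θ.toCircle * ψ θ ∂haarAddCircle)) := by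
  have hmem : ∀ᶠ r : ℝ in 𝓝[<] 1, r ∈ Set.Ioo (0 : ℝ) 1 := Ioo_mem_nhdsLT (by norm_num)
  refine tendsto_integral_filter_of_dominated_convergence (fun θ => C * ‖ψ θ‖) ?_ ?_
    (hψ.norm.const_mul C) ?_
  · filter_upwards [hmem] with r hr
    exact (continuous_comp_circle hh hr.1.le hr.2).aestronglyMeasurable.mul hψ.1
  · filter_upwards [hmem] with r hr
    refine ae_of_all _ fun θ => ?_
    rw [norm_mul]
    gcongr
    exact hC _ (by simpa [abs_of_pos hr.1] using hr.2)
  · filter_upwards [hb] with θ hθ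
    refine Tendsto.mul_const _ (hθ.tendsto.comp ?_)
    have : Tendsto (fun r : ℝ => (r : ℂ) * θ.toCircle) (𝓝 1) (𝓝 (((1 : ℝ) : ℂ) * θ.toCircle)) :=
      Continuous.tendsto (by fun_prop) 1
    rw [Complex.ofReal_one, one_mul] at this
    exact this.mono_left nhdsWithin_le_nhds

/-- Integration by parts turns the coefficient of `f` into that of `f'` divided by `k`, up to a
unimodular factor; the boundary term cancels by periodicity. The coefficients of the bounded `f'`
are square summable. -/
theorem summable_norm_integral_pow_mul {f : UnitCircle → ℂ} {f' : ℝ → ℂ} {C : ℝ}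
    (hf : ∀ x : ℝ, HasDerivAt (fun y : ℝ => f y) (f' x) x) (hC : ∀ x, ‖f' x‖ ≤ C) :
    Summable fun k : ℕ => ‖∫ θ : UnitCircle, (θ.toCircle : ℂ) ^ k * f θ ∂haarAddCircle‖ := by
  have hT : (0 : ℝ) < 0 + 2 * π := by positivity
  have hm : Measurable f' := by
    have : f' = deriv fun y : ℝ => f y := funext fun x => (hf x).deriv.symm
    rw [this]; exact measurable_deriv _
  have hL : MemLp f' 2 (volume.restrict (Set.Ioc 0 (0 + 2 * π))) :=
    MemLp.of_bound hm.aestronglyMeasurable C (ae_of_all _ hC)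
  have hI : IntervalIntegrable f' volume 0 (0 + 2 * π) := by
    rw [intervalIntegrable_iff_integrableOn_Ioc_of_le hT.le]
    exact hL.integrable one_le_two
  have h1 := (hasSum_sq_fourierCoeffOn hT hL).summable
  have h2 : Summable fun k : ℕ => ‖fourierCoeffOn hT f' (-(k : ℤ))‖ ^ 2 :=
    h1.comp_injective (i := fun k : ℕ => -(k : ℤ)) fun a b h => by simpa using h
  have h3 : Summable fun k : ℕ => 1 / (k : ℝ) ^ 2 := Real.summable_one_div_nat_pow.2 one_lt_two
  refine (h2.add h3).of_norm_bounded_eventually_nat ?_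
  filter_upwards [eventually_ge_atTop 1] with k hk
  have hk0 : -(k : ℤ) ≠ 0 := by omega
  have e1 : ∫ θ : UnitCircle, (θ.toCircle : ℂ) ^ k * f θ ∂haarAddCircle
      = fourierCoeff f (-(k : ℤ)) := by
    refine integral_congr_ae (ae_of_all _ fun θ => ?_)
    simp only [neg_neg, smul_eq_mul]
    rw [fourier_apply, natCast_zsmul, AddCircle.toCircle_nsmul, Circle.coe_pow]
  have e2 : fourierCoeff f (-(k : ℤ)) = fourierCoeffOn hT (fun y : ℝ => f y) (-(k : ℤ)) := by
    rw [← fourierCoeff_liftIoc_eq (T := 2 * π) (a := 0)]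
    congr 1
    ext θ
    obtain ⟨x, hx, rfl⟩ := AddCircle.eq_coe_Ioc θ
    rw [AddCircle.liftIoc_coe_apply (by simpa using hx)]
  have e3 : f ((0 + 2 * π : ℝ) : UnitCircle) = f ((0 : ℝ) : UnitCircle) := by
    rw [AddCircle.coe_add_period]
  rw [norm_norm, e1, e2, fourierCoeffOn_of_hasDerivAt hT hk0 (fun x _ => hf x) hI, e3, sub_self,
    mul_zero, zero_sub]
  have hk' : (0 : ℝ) < k := by exact_mod_cast hk
  set A := ‖fourierCoeffOn hT f' (-(k : ℤ))‖
  have e4 : ‖(1 / (-2 * π * Complex.I * ((-(k : ℤ) : ℤ) : ℂ)) : ℂ) *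
      -((((0 + 2 * π : ℝ) : ℂ) - ((0 : ℝ) : ℂ)) * fourierCoeffOn hT f' (-(k : ℤ)))‖ = A * (1 / k) := by
    simp [A, abs_of_pos Real.pi_pos]
    field_simp
  rw [e4]
  have : 1 / (k : ℝ) ^ 2 = (1 / (k : ℝ)) ^ 2 := by rw [one_div_pow]
  rw [this]
  -- The bound is `A / k ≤ A² + 1 / k²`.
  nlinarith [sq_nonneg (A - 1 / k), sq_nonneg A, sq_nonneg (1 / (k : ℝ))]

/-! ### Arc distance against chord distance. -/

theorem exists_coe_eq_abs_eq_norm (x : UnitCircle) : ∃ y : ℝ, (y : UnitCircle) = x ∧ |y| = ‖x‖ := by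
  induction x using QuotientAddGroup.induction_on with
  | H z =>
    refine ⟨z - round ((2 * π)⁻¹ * z) * (2 * π), ?_, (AddCircle.norm_eq _).symm⟩
    have : ((round ((2 * π)⁻¹ * z) * (2 * π) : ℝ) : UnitCircle) = 0 :=
      AddCircle.coe_eq_zero_iff _ |>.2 ⟨round ((2 * π)⁻¹ * z), by simp⟩
    rw [AddCircle.coe_sub, this, sub_zero]

theorem coe_toCircle_coe (x : ℝ) :
    (AddCircle.toCircle (x : UnitCircle) : ℂ) = Complex.exp (Complex.I * x) := by
  rw [AddCircle.toCircle_apply_mk, Circle.coe_exp, div_self Real.two_pi_pos.ne', one_mul, mul_comm]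

theorem norm_toCircle_sub (a b : UnitCircle) :
    ∃ y : ℝ, |y| = dist a b ∧ |y| ≤ π ∧
      ‖(a.toCircle : ℂ) - (b.toCircle : ℂ)‖ = 2 * |Real.sin (y / 2)| := by
  obtain ⟨y, hy, hy'⟩ := exists_coe_eq_abs_eq_norm (a - b)
  refine ⟨y, by rw [hy', dist_eq_norm], ?_, ?_⟩
  · rw [hy']
    refine (AddCircle.norm_le_half_period _ Real.two_pi_pos.ne').trans_eq ?_
    rw [abs_of_pos Real.two_pi_pos]; ring
  · have : a = y + b := by rw [hy]; abel
    rw [this, AddCircle.toCircle_add, Circle.coe_mul, ← sub_one_mul, norm_mul, norm_toCircle,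
      mul_one, coe_toCircle_coe, Complex.norm_exp_I_mul_ofReal_sub_one]
    simp

theorem norm_toCircle_sub_le (a b : UnitCircle) :
    ‖(a.toCircle : ℂ) - (b.toCircle : ℂ)‖ ≤ dist a b := by
  obtain ⟨y, h1, -, h2⟩ := norm_toCircle_sub a b
  rw [h2, ← h1]
  have := Real.abs_sin_le_abs (x := y / 2)
  rw [abs_div, abs_two] at this
  linarith

theorem dist_le_norm_toCircle_sub (a b : UnitCircle) :
    dist a b ≤ 2 * ‖(a.toCircle : ℂ) - (b.toCircle : ℂ)‖ := by
  obtain ⟨y, h1, h3, h2⟩ := norm_toCircle_sub a b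
  rw [h2, ← h1]
  have := Real.mul_abs_le_abs_sin (x := y / 2) (by rw [abs_div, abs_two]; linarith)
  rw [abs_div, abs_two] at this
  have h4 : 1 / 2 ≤ 2 / π := by
    rw [div_le_div_iff₀ two_pos Real.pi_pos]; linarith [Real.pi_le_four]
  nlinarith [abs_nonneg y]

theorem infDist_le_infDist_toCircle {E : Set UnitCircle} (hE : E.Nonempty) (θ : UnitCircle) :
    Metric.infDist θ E
      ≤ 2 * Metric.infDist (θ.toCircle : ℂ) ((fun x : UnitCircle => (x.toCircle : ℂ)) '' E) := by
  suffices Metric.infDist θ E / 2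
      ≤ Metric.infDist (θ.toCircle : ℂ) ((fun x : UnitCircle => (x.toCircle : ℂ)) '' E) by linarith
  refine (Metric.le_infDist (hE.image _)).2 ?_
  rintro _ ⟨e, he, rfl⟩
  have h1 := Metric.infDist_le_dist_of_mem (x := θ) he
  have h2 := dist_le_norm_toCircle_sub θ e
  rw [dist_eq_norm]
  linarith

/-! ### Smoothness of the test functions on the circle. -/

/-- The image of a set of angles on the unit circle of the complex plane. -/
def circleImage (E : Set UnitCircle) : Set ℂ := (fun θ : UnitCircle => (θ.toCircle : ℂ)) '' E

section

variable {E : Set UnitCircle}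

theorem isClosed_circleImage (hE : IsClosed E) : IsClosed (circleImage E) :=
  (hE.isCompact.image continuous_coe_toCircle).isClosed

theorem circleImage_subset_sphere : circleImage E ⊆ Metric.sphere 0 1 := by
  rintro _ ⟨θ, -, rfl⟩
  simp

theorem infDist_circleImage_pos (hE : IsClosed E) (hE0 : E.Nonempty) {θ : UnitCircle}
    (hθ : θ ∉ E) : 0 < Metric.infDist (θ.toCircle : ℂ) (circleImage E) := by
  have h1 := (hE.notMem_iff_infDist_pos hE0).1 hθ
  have h2 := infDist_le_infDist_toCircle hE0 θ
  unfold circleImage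
  linarith

/-- The derivatives of the Herglotz transforms grow at most like `ρ⁻²` at `E`, which the quadratic
decay of `exp (-H ν)` cancels, while `exp (H κ)` is unimodular on the circle. The factor `4` is the
square of the ratio between arc and chord distances. -/
theorem norm_deriv_exp_mul_le {m : ℕ} {ν κ : Measure ℂ} [IsFiniteMeasure ν] [IsFiniteMeasure κ]
    {C : ℝ} (hE : IsClosed E) (hE0 : E.Nonempty)
    (hν : CarriedNear ν (circleImage E)) (hκ : CarriedNear κ (circleImage E))
    (hκ1 : ∀ᵐ w ∂κ, ‖w‖ = 1)
    (hdec : ∀ θ : UnitCircle, θ ∉ E →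
      ‖Complex.exp (-herglotz ν θ.toCircle)‖ ≤ C * Metric.infDist θ E ^ 2)
    {θ : UnitCircle} (hθ : θ ∉ E) :
    ∃ G' : ℂ, HasDerivAt (fun z => z ^ m * Complex.exp (-herglotz ν z + herglotz κ z)) G' θ.toCircle ∧
      ‖G'‖ ≤ m + C * 4 * (36 * ν.real Set.univ + 36 * κ.real Set.univ) := by
  set ζ : ℂ := (θ.toCircle : ℂ)
  have hζ : ‖ζ‖ = 1 := norm_toCircle θ
  have hρ : 0 < Metric.infDist ζ (circleImage E) := infDist_circleImage_pos hE hE0 hθ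
  have hd := infDist_le_infDist_toCircle hE0 θ
  change _ ≤ 2 * Metric.infDist ζ (circleImage E) at hd
  set ρ := Metric.infDist ζ (circleImage E)
  have d1 := hν.hasDerivAt_herglotz hζ.le hρ
  have d2 := hκ.hasDerivAt_herglotz hζ.le hρ
  have b1 := hν.norm_deriv_herglotz_le hζ.le hρ
  have b2 := hκ.norm_deriv_herglotz_le hζ.le hρ
  set H1 := ∫ w, 2 * w / (w - ζ) ^ 2 ∂ν
  set H2 := ∫ w, 2 * w / (w - ζ) ^ 2 ∂κ
  refine ⟨_, (hasDerivAt_pow m ζ).mul (d1.neg.add d2).cexp, ?_⟩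
  have hdE := hdec θ hθ
  have hle1 : ‖Complex.exp (-herglotz ν ζ)‖ ≤ 1 := norm_exp_neg_herglotz_le_one hν hζ.le
  have hee : ‖Complex.exp (-herglotz ν ζ + herglotz κ ζ)‖ = ‖Complex.exp (-herglotz ν ζ)‖ := by
    rw [Complex.norm_exp, Complex.norm_exp, Complex.add_re, re_herglotz_eq_zero hκ1 hζ, add_zero]
  set e := ‖Complex.exp (-herglotz ν ζ)‖
  have hd0 : 0 ≤ Metric.infDist θ E := Metric.infDist_nonneg
  have hdp : 0 < Metric.infDist θ E := (hE.notMem_iff_infDist_pos hE0).1 hθ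
  have he0 : 0 ≤ e := norm_nonneg _
  have hC : 0 ≤ C := by
    by_contra hc
    have : C * Metric.infDist θ E ^ 2 < 0 := mul_neg_of_neg_of_pos (by linarith) (by positivity)
    change e ≤ _ at hdE
    linarith
  have heρ : e ≤ C * 4 * ρ ^ 2 := by
    refine hdE.trans ?_
    have : Metric.infDist θ E ^ 2 ≤ 4 * ρ ^ 2 := by nlinarith
    nlinarith
  have hH : ‖-H1 + H2‖ ≤ (36 * ν.real Set.univ + 36 * κ.real Set.univ) / ρ ^ 2 := by
    refine (norm_add_le _ _).trans ?_
    rw [norm_neg]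
    refine (add_le_add b1 b2).trans_eq ?_
    ring
  set A := 36 * ν.real Set.univ + 36 * κ.real Set.univ
  refine (norm_add_le _ _).trans ?_
  simp only [norm_mul, norm_pow, hζ, one_pow, one_mul, mul_one, Complex.norm_natCast, hee]
  rw [show ‖Complex.exp ((-herglotz ν + herglotz κ) ζ)‖ = e from hee]
  have t1 : (m : ℝ) * e ≤ m := mul_le_of_le_one_right (Nat.cast_nonneg _) hle1
  have t2 : e * ‖-H1 + H2‖ ≤ C * 4 * A := by
    calc e * ‖-H1 + H2‖ ≤ (C * 4 * ρ ^ 2) * (A / ρ ^ 2) := by gcongr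
      _ = C * 4 * A := by field_simp
  linarith

/-- Off `E` this is the chain rule. At a point of `E` the function is `O(|y - x|²)`, so its
derivative exists and is `0`. -/
theorem exists_bounded_deriv {m : ℕ} {ν κ : Measure ℂ} [IsFiniteMeasure ν] [IsFiniteMeasure κ]
    {C : ℝ} (hC : 0 ≤ C) (hE : IsClosed E) (hE0 : E.Nonempty)
    (hν : CarriedNear ν (circleImage E)) (hκ : CarriedNear κ (circleImage E))
    (hκ1 : ∀ᵐ w ∂κ, ‖w‖ = 1)
    (hdec : ∀ θ : UnitCircle, θ ∉ E →
      ‖Complex.exp (-herglotz ν θ.toCircle)‖ ≤ C * Metric.infDist θ E ^ 2)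
    {φ : UnitCircle → ℂ} (hφ0 : ∀ θ ∈ E, φ θ = 0)
    (hφ : ∀ θ : UnitCircle, θ ∉ E → φ θ = (θ.toCircle : ℂ) ^ m *
      Complex.exp (-herglotz ν θ.toCircle + herglotz κ θ.toCircle)) (x : ℝ) :
    ∃ φ' : ℂ, HasDerivAt (fun y : ℝ => φ y) φ' x ∧
      ‖φ'‖ ≤ m + C * 4 * (36 * ν.real Set.univ + 36 * κ.real Set.univ) := by
  by_cases hx : (x : UnitCircle) ∈ E
  · refine ⟨0, ?_, by rw [norm_zero]; positivity⟩
    have hO : (fun y : ℝ => φ y) =O[𝓝 x] fun y => ‖y - x‖ ^ 2 := by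
      refine Asymptotics.IsBigO.of_bound C (Eventually.of_forall fun y => ?_)
      by_cases hy : (y : UnitCircle) ∈ E
      · rw [hφ0 _ hy, norm_zero]; positivity
      · have hd : Metric.infDist (y : UnitCircle) E ≤ ‖y - x‖ := by
          refine (Metric.infDist_le_dist_of_mem hx).trans ?_
          rw [dist_eq_norm, ← AddCircle.coe_sub, Real.norm_eq_abs]
          -- The norm on the circle agrees with `|y - x|` up to half a period, and never exceeds
          -- `π`.
          obtain h | h := le_or_gt |y - x| π
          · refine ((AddCircle.norm_coe_eq_abs_iff _ Real.two_pi_pos.ne').2 ?_).le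
            rw [abs_of_pos Real.two_pi_pos]; linarith
          · refine (AddCircle.norm_le_half_period _ Real.two_pi_pos.ne').trans ?_
            rw [abs_of_pos Real.two_pi_pos]; linarith
        have hn : ‖(toCircle (y : UnitCircle) : ℂ)‖ = 1 := norm_toCircle _
        rw [hφ _ hy, norm_mul, norm_pow, hn, one_pow, one_mul, Complex.norm_exp, Complex.add_re,
          re_herglotz_eq_zero hκ1 hn, add_zero, ← Complex.norm_exp, norm_pow, norm_norm]
        refine (hdec _ hy).trans ?_
        have := Metric.infDist_nonneg (x := (y : UnitCircle)) (s := E)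
        gcongr
    exact (hO.hasFDerivAt one_lt_two).hasDerivAt
  · obtain ⟨G', hG, hb⟩ := norm_deriv_exp_mul_le (m := m) hE hE0 hν hκ hκ1 hdec hx
    have hc : HasDerivAt (fun y : ℝ => (toCircle (y : UnitCircle) : ℂ))
        (Complex.exp (Complex.I * x) * Complex.I) x := by
      simp_rw [coe_toCircle_coe]
      have := ((hasDerivAt_id (x : ℂ)).const_mul Complex.I).cexp.comp_ofReal
      simpa using this
    refine ⟨_, (hG.comp x hc).congr_of_eventuallyEq ?_, ?_⟩
    · have hopen : ∀ᶠ y : ℝ in 𝓝 x, (y : UnitCircle) ∈ Eᶜ :=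
        (AddCircle.continuous_mk' (2 * π)).continuousAt.eventually_mem (hE.isOpen_compl.mem_nhds hx)
      filter_upwards [hopen] with y hy
      exact hφ _ hy
    · rw [norm_mul, norm_mul, Complex.norm_I, mul_one, mul_comm Complex.I, Complex.norm_exp_ofReal_mul_I,
        mul_one]
      exact hb

end

/-! ### Cyclicity forces the test functions to have integral zero. -/

theorem integral_haar_mul_pow_eq_zero {f : ℂ → ℂ} (hf : DifferentiableOn ℂ f (Metric.ball 0 1))
    {C : ℝ} (hC : ∀ z : ℂ, ‖z‖ < 1 → ‖f z‖ ≤ C)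
    (hb : ∀ᵐ θ : UnitCircle ∂haarAddCircle, ContinuousAt f θ.toCircle) (hf0 : f 0 = 0) :
    ∫ θ : UnitCircle, f θ.toCircle ∂haarAddCircle = 0 := by
  have h1 := tendsto_integral_radial hf hC hb (integrable_const (1 : ℂ))
  simp only [mul_one] at h1
  refine tendsto_nhds_unique h1 (tendsto_const_nhds.congr' ?_)
  filter_upwards [Ioo_mem_nhdsLT (show (0 : ℝ) < 1 by norm_num)] with r hr
  have := integral_mul_conj_pow hf hr.1.le hr.2 0
  simp only [pow_zero, map_one, mul_one] at this
  rw [this]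
  simp [maclaurinCoeff, hf0]

section

variable {E : Set UnitCircle}

theorem ae_haar_notMem (hE : volume E = 0) : ∀ᵐ θ : UnitCircle ∂haarAddCircle, θ ∉ E := by
  rw [volume_eq_smul_haarAddCircle] at hE
  have : haarAddCircle E = 0 := by
    simpa [Real.pi_pos.not_ge, Real.two_pi_pos.not_ge] using hE
  exact compl_mem_ae_iff.2 this

/-- This is `ℓ^∞`–`ℓ^1` duality on circles of radius `r < 1`, uniform in `r`, passed to the limit.
-/
theorem norm_integral_mul_le {f : ℂ → ℂ} (hf : DifferentiableOn ℂ f (Metric.ball 0 1)) {C ε : ℝ}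
    (hC : ∀ z : ℂ, ‖z‖ < 1 → ‖f z‖ ≤ C)
    (hb : ∀ᵐ θ : UnitCircle ∂haarAddCircle, ContinuousAt f θ.toCircle)
    (hε : ∀ k, ‖maclaurinCoeff f k‖ ≤ ε) {φ : UnitCircle → ℂ} (hφ : Integrable φ haarAddCircle)
    (hs : Summable fun k : ℕ => ‖∫ θ : UnitCircle, (θ.toCircle : ℂ) ^ k * φ θ ∂haarAddCircle‖) :
    ‖∫ θ : UnitCircle, f θ.toCircle * φ θ ∂haarAddCircle‖
      ≤ ε * ∑' k : ℕ, ‖∫ θ : UnitCircle, (θ.toCircle : ℂ) ^ k * φ θ ∂haarAddCircle‖ := by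
  refine le_of_tendsto (tendsto_integral_radial hf hC hb hφ).norm ?_
  filter_upwards [Ioo_mem_nhdsLT (show (0 : ℝ) < 1 by norm_num)] with r hr
  rw [← (hasSum_integral_mul hf hφ hr.1.le hr.2).tsum_eq]
  refine tsum_of_norm_bounded (hs.hasSum.mul_left ε) fun k => ?_
  rw [norm_mul, norm_mul, norm_pow, Complex.norm_real, Real.norm_of_nonneg hr.1.le]
  gcongr
  calc _ ≤ ε * 1 := mul_le_mul (hε k) (pow_le_one₀ hr.1.le hr.2.le) (by have := hr.1; positivity)
        ((norm_nonneg _).trans (hε k))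
    _ = ε := mul_one ε

theorem measurable_herglotz (ν : Measure ℂ) [SFinite ν] : Measurable (herglotz ν) := by
  have : StronglyMeasurable (Function.uncurry fun z w : ℂ => (w + z) / (w - z)) :=
    Measurable.stronglyMeasurable (by unfold Function.uncurry; fun_prop)
  exact this.integral_prod_right.measurable

/-- The annihilation property: if `S = exp (-H κ)` is cyclic, then the functionals attached to the
smooth functions `z ^ m * exp (-H ν) / S` kill the constants. -/
theorem integral_eq_zero_of_cyclic {m : ℕ} (hm : m ≠ 0) {ν κ : Measure ℂ} [IsFiniteMeasure ν]
    [IsFiniteMeasure κ] {C : ℝ} (hC : 0 ≤ C) (hE : IsClosed E) (hE0 : E.Nonempty)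
    (hEv : volume E = 0)
    (hν : CarriedNear ν (circleImage E)) (hκ : CarriedNear κ (circleImage E))
    (hκ1 : ∀ᵐ w ∂κ, ‖w‖ = 1)
    (hdec : ∀ θ : UnitCircle, θ ∉ E →
      ‖Complex.exp (-herglotz ν θ.toCircle)‖ ≤ C * Metric.infDist θ E ^ 2)
    {p : ℝ} (hp : 0 < p) (hcyc : IsCyclicEllpA p fun z => Complex.exp (-herglotz κ z)) :
    ∫ θ : UnitCircle, (θ.toCircle : ℂ) ^ m *
      Complex.exp (-herglotz ν θ.toCircle + herglotz κ θ.toCircle) ∂haarAddCircle = 0 := by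
  classical
  obtain ⟨-, P, hP⟩ := hcyc
  have hKc := isClosed_circleImage hE
  have hK0 : (circleImage E).Nonempty := hE0.image _
  -- On `E` the Herglotz transforms may take default values; prescribing `0` there makes `φ`
  -- continuous.
  set φ : UnitCircle → ℂ := fun θ => if θ ∈ E then 0 else (θ.toCircle : ℂ) ^ m *
      Complex.exp (-herglotz ν θ.toCircle + herglotz κ θ.toCircle) with hφdef
  have hφd := exists_bounded_deriv (m := m) hC hE hE0 hν hκ hκ1 hdec (φ := φ)
    (fun θ h => if_pos h) (fun θ h => if_neg h)
  choose φ' hφ' hφb using hφd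
  have hφc : Continuous φ := by
    have h1 : Continuous fun y : ℝ => φ y :=
      continuous_iff_continuousAt.2 fun x => (hφ' x).continuousAt
    exact (QuotientAddGroup.isQuotientMap_mk _).continuous_iff.2 h1
  have hφi : Integrable φ haarAddCircle :=
    hφc.integrable_of_hasCompactSupport (HasCompactSupport.of_compactSpace _)
  have hs := summable_norm_integral_pow_mul hφ' hφb
  have hae := ae_haar_notMem hEv
  have hdν := hν.differentiableOn_herglotz hKc hK0 circleImage_subset_sphere
  have hdκ := hκ.differentiableOn_herglotz hKc hK0 circleImage_subset_sphere
  have hcν : ∀ θ : UnitCircle, θ ∉ E → ContinuousAt (herglotz ν) θ.toCircle := fun θ hθ =>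
    (hν.hasDerivAt_herglotz (norm_toCircle θ).le (infDist_circleImage_pos hE hE0 hθ)).continuousAt
  have hcκ : ∀ θ : UnitCircle, θ ∉ E → ContinuousAt (herglotz κ) θ.toCircle := fun θ hθ =>
    (hκ.hasDerivAt_herglotz (norm_toCircle θ).le (infDist_circleImage_pos hE hE0 hθ)).continuousAt
  have hPb : ∀ n, ∃ B, ∀ z : ℂ, ‖z‖ ≤ 1 → ‖(P n).eval z‖ ≤ B := fun n => by
    obtain ⟨B, hB⟩ := (isCompact_closedBall (0 : ℂ) 1).exists_bound_of_continuousOn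
      (P n).continuous.continuousOn
    exact ⟨B, fun z hz => hB z (by simpa using hz)⟩
  have hφe : ∫ θ : UnitCircle, (θ.toCircle : ℂ) ^ m *
      Complex.exp (-herglotz ν θ.toCircle + herglotz κ θ.toCircle) ∂haarAddCircle
      = ∫ θ, φ θ ∂haarAddCircle := by
    refine integral_congr_ae ?_
    filter_upwards [hae] with θ hθ
    simp [hφdef, hθ]
  rw [hφe]
  set f : ℕ → ℂ → ℂ := fun n z => (P n).eval z * Complex.exp (-herglotz κ z) - 1 with hfdef
  set σ := ∑' k : ℕ, ‖∫ θ : UnitCircle, (θ.toCircle : ℂ) ^ k * φ θ ∂haarAddCircle‖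
  have key : ∀ n, ∀ ε : ℝ, (∀ k, ‖maclaurinCoeff (f n) k‖ ≤ ε) →
      ‖∫ θ, φ θ ∂haarAddCircle‖ ≤ ε * σ := fun n ε hε => by
    obtain ⟨B, hB⟩ := hPb n
    have hf : DifferentiableOn ℂ (f n) (Metric.ball 0 1) :=
      ((P n).differentiable.differentiableOn.mul hdκ.neg.cexp).sub_const 1
    have hfb : ∀ z : ℂ, ‖z‖ < 1 → ‖f n z‖ ≤ B * 1 + 1 := fun z hz => by
      refine (norm_sub_le _ _).trans ?_
      rw [norm_mul, norm_one]
      gcongr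
      · exact (norm_nonneg _).trans (hB z hz.le)
      · exact hB z hz.le
      · exact norm_exp_neg_herglotz_le_one hκ hz.le
    have hfc : ∀ᵐ θ : UnitCircle ∂haarAddCircle, ContinuousAt (f n) θ.toCircle := by
      filter_upwards [hae] with θ hθ
      exact ((P n).continuous.continuousAt.mul (hcκ θ hθ).neg.cexp).sub continuousAt_const
    have h1 := norm_integral_mul_le hf hfb hfc hε hφi hs
    set g : ℂ → ℂ := fun z => (P n).eval z * (z ^ m * Complex.exp (-herglotz ν z)) with hgdef
    -- The mean over the circle is `g 0`, which vanishes because `m ≠ 0`.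
    have hg : ∫ θ : UnitCircle, g θ.toCircle ∂haarAddCircle = 0 := by
      refine integral_haar_mul_pow_eq_zero (C := B * (1 * 1)) ?_ ?_ ?_ ?_
      · exact (P n).differentiable.differentiableOn.mul
          ((differentiable_pow m).differentiableOn.mul hdν.neg.cexp)
      · intro z hz
        rw [norm_mul, norm_mul, norm_pow]
        gcongr
        · exact (norm_nonneg _).trans (hB z hz.le)
        · exact hB z hz.le
        · exact pow_le_one₀ (norm_nonneg _) hz.le
        · exact norm_exp_neg_herglotz_le_one hν hz.le
      · filter_upwards [hae] with θ hθ
        exact (P n).continuous.continuousAt.mul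
          ((continuous_pow m).continuousAt.mul (hcν θ hθ).neg.cexp)
      · simp [hgdef, hm]
    -- Off `E`, the factor `1 / S` in `φ` cancels the `S` in `f n`; hence `∫ f n φ = -∫ φ`.
    have hfg : ∀ᵐ θ : UnitCircle ∂haarAddCircle,
        f n θ.toCircle * φ θ = g θ.toCircle - φ θ := by
      filter_upwards [hae] with θ hθ
      have : Complex.exp (-herglotz κ θ.toCircle) * Complex.exp (herglotz κ θ.toCircle) = 1 := by
        rw [← Complex.exp_add]; simp
      simp only [hφdef, hfdef, hgdef, if_neg hθ, Complex.exp_add]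
      linear_combination (Polynomial.eval (θ.toCircle : ℂ) (P n) * (θ.toCircle : ℂ) ^ m *
        Complex.exp (-herglotz ν θ.toCircle)) * this
    have hgi : Integrable (fun θ : UnitCircle => g θ.toCircle) haarAddCircle := by
      refine Integrable.of_bound (C := B * (1 * 1)) ?_ (ae_of_all _ fun θ => ?_)
      · have := (measurable_herglotz ν).comp continuous_coe_toCircle.measurable
        have h2 := ((P n).continuous.comp continuous_coe_toCircle).measurable
        exact (h2.mul ((continuous_coe_toCircle.pow m).measurable.mul
          this.neg.cexp)).aestronglyMeasurable
      · have hz := norm_toCircle θ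
        rw [norm_mul, norm_mul, norm_pow, hz, one_pow]
        gcongr
        · exact (norm_nonneg _).trans (hB _ hz.le)
        · exact hB _ hz.le
        · exact norm_exp_neg_herglotz_le_one hν hz.le
    rwa [integral_congr_ae hfg, integral_sub hgi hφi, hg, zero_sub, norm_neg] at h1
  have hlim : Tendsto (fun n => (ellpNorm p (f n)).toReal * σ) atTop (𝓝 (0 * σ)) := by
    refine Tendsto.mul_const _ ?_
    have := (ENNReal.tendsto_toReal ENNReal.zero_ne_top).comp hP
    simpa [Function.comp_def] using this
  rw [zero_mul] at hlim
  have hfin : ∀ᶠ n in atTop, ellpNorm p (f n) < ∞ := hP.eventually_lt_const ENNReal.zero_lt_top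
  have : ‖∫ θ, φ θ ∂haarAddCircle‖ ≤ 0 := by
    refine ge_of_tendsto hlim ?_
    filter_upwards [hfin] with n hn
    refine key n _ fun k => ?_
    have := ENNReal.toReal_mono hn.ne (enorm_maclaurinCoeff_le_ellpNorm hp (f n) k)
    simpa using this
  exact norm_le_zero_iff.1 this

end

/-! ### Exterior measures whose outer functions vanish quadratically on `E`. -/

/-- The part at distance `(1 / 2) ^ k` from the unit circle of the exterior measure attached to `E`:
arc length on the `(1 / 2) ^ k`-neighbourhood of `E`, moved to the circle of radius
`1 + (1 / 2) ^ k`. -/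
noncomputable def exteriorLayer (E : Set UnitCircle) (k : ℕ) : Measure ℂ :=
  ((volume : Measure UnitCircle).restrict (Metric.thickening ((1 / 2) ^ k) E)).map
    fun θ => ((1 + (1 / 2) ^ k : ℝ) : ℂ) * θ.toCircle

/-- The exterior measure attached to `E`, from the `n`-th layer on. -/
noncomputable def exteriorMeasure (E : Set UnitCircle) (n : ℕ) : Measure ℂ :=
  Measure.sum fun k => (9 : ℝ≥0∞) • exteriorLayer E (n + k)

section

variable {E : Set UnitCircle}

theorem measurable_const_mul_toCircle (c : ℂ) :
    Measurable fun θ : UnitCircle => c * θ.toCircle :=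
  (continuous_const.mul continuous_coe_toCircle).measurable

theorem measurableSet_le_infDist_sub (K : Set ℂ) :
    MeasurableSet {w : ℂ | 1 ≤ ‖w‖ ∧ ‖w‖ ≤ 2 ∧
      ∀ z : ℂ, ‖z‖ ≤ 1 → Metric.infDist z K ≤ 3 * ‖w - z‖} := by
  have : {w : ℂ | 1 ≤ ‖w‖ ∧ ‖w‖ ≤ 2 ∧ ∀ z : ℂ, ‖z‖ ≤ 1 → Metric.infDist z K ≤ 3 * ‖w - z‖}
      = {w | 1 ≤ ‖w‖} ∩ ({w | ‖w‖ ≤ 2} ∩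
        ⋂ z : ℂ, ⋂ _ : ‖z‖ ≤ 1, {w | Metric.infDist z K ≤ 3 * ‖w - z‖}) := by
    ext; simp
  rw [this]
  exact IsClosed.measurableSet <| (isClosed_le continuous_const continuous_norm).inter <|
    (isClosed_le continuous_norm continuous_const).inter <|
    isClosed_iInter fun z => isClosed_iInter fun _ => isClosed_le continuous_const (by fun_prop)

/-- The constant `3`: `w` is within `ε` of a circle point that is itself within `ε` of `E`, and `ε ≤
‖w‖ - ‖z‖ ≤ ‖w - z‖`. -/
theorem carriedNear_exteriorLayer (k : ℕ) :
    CarriedNear (exteriorLayer E k) (circleImage E) := by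
  unfold CarriedNear exteriorLayer
  rw [ae_map_iff (measurable_const_mul_toCircle _).aemeasurable (measurableSet_le_infDist_sub _)]
  filter_upwards [ae_restrict_mem Metric.isOpen_thickening.measurableSet] with θ hθ
  set ε : ℝ := (1 / 2) ^ k
  have hε0 : 0 < ε := by positivity
  have hε1 : ε ≤ 1 := pow_le_one₀ (by norm_num) (by norm_num)
  have hn : ‖((1 + ε : ℝ) : ℂ) * θ.toCircle‖ = 1 + ε := by
    rw [norm_mul, norm_toCircle, mul_one, Complex.norm_real, Real.norm_of_nonneg (by positivity)]
  refine ⟨by linarith, by linarith, fun z hz => ?_⟩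
  obtain ⟨e, he, hd⟩ := Metric.mem_thickening_iff.1 hθ
  have h1 : Metric.infDist z (circleImage E) ≤ dist z e.toCircle :=
    Metric.infDist_le_dist_of_mem ⟨e, he, rfl⟩
  set w : ℂ := ((1 + ε : ℝ) : ℂ) * θ.toCircle
  have h2 : ε ≤ ‖w - z‖ := by
    have := norm_sub_norm_le w z
    linarith
  have h3 : ‖w - θ.toCircle‖ = ε := by
    have : w - θ.toCircle = (ε : ℂ) * θ.toCircle := by simp only [w]; push_cast; ring
    rw [this, norm_mul, norm_toCircle, mul_one, Complex.norm_real, Real.norm_of_nonneg hε0.le]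
  have h4 := norm_toCircle_sub_le θ e
  have h5 : dist z e.toCircle ≤ ‖w - z‖ + ‖w - θ.toCircle‖
      + ‖(θ.toCircle : ℂ) - (e.toCircle : ℂ)‖ := by
    rw [dist_eq_norm]
    have : z - (e.toCircle : ℂ) = -(w - z) + (w - θ.toCircle) + (θ.toCircle - e.toCircle) := by ring
    rw [this]
    refine (norm_add₃_le).trans ?_
    rw [norm_neg]
  linarith

theorem carriedNear_exteriorMeasure (n : ℕ) :
    CarriedNear (exteriorMeasure E n) (circleImage E) := by
  unfold CarriedNear exteriorMeasure
  rw [Measure.ae_sum_iff]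
  exact fun k => Measure.ae_smul_measure (carriedNear_exteriorLayer (n + k)) _

theorem exteriorLayer_univ (k : ℕ) :
    exteriorLayer E k Set.univ = volume (Metric.thickening ((1 / 2) ^ k) E) := by
  rw [exteriorLayer, Measure.map_apply (measurable_const_mul_toCircle _) MeasurableSet.univ]
  simp

theorem exteriorMeasure_univ
    (hs : Summable fun k : ℕ => volume.real (Metric.thickening ((1 / 2) ^ k) E)) (n : ℕ) :
    exteriorMeasure E n Set.univ
      = ENNReal.ofReal (9 * ∑' k : ℕ, volume.real (Metric.thickening ((1 / 2) ^ (k + n)) E)) := by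
  have hs' := (summable_nat_add_iff n).2 hs
  rw [exteriorMeasure, Measure.sum_apply _ MeasurableSet.univ, ENNReal.ofReal_mul (by norm_num),
    ENNReal.ofReal_tsum_of_nonneg (fun _ => measureReal_nonneg) hs', ← ENNReal.tsum_mul_left]
  refine tsum_congr fun k => ?_
  rw [Measure.smul_apply, exteriorLayer_univ, smul_eq_mul, ofReal_measureReal, add_comm]
  norm_num

theorem isFiniteMeasure_exteriorMeasure
    (hs : Summable fun k : ℕ => volume.real (Metric.thickening ((1 / 2) ^ k) E)) (n : ℕ) :
    IsFiniteMeasure (exteriorMeasure E n) :=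
  ⟨by rw [exteriorMeasure_univ hs]; exact ENNReal.ofReal_lt_top⟩

theorem tendsto_exteriorMeasure_univ
    (hs : Summable fun k : ℕ => volume.real (Metric.thickening ((1 / 2) ^ k) E)) :
    Tendsto (fun n => (exteriorMeasure E n).real Set.univ) atTop (𝓝 0) := by
  have h := (tendsto_sum_nat_add fun k : ℕ => volume.real (Metric.thickening ((1 / 2) ^ k) E))
  have h9 := h.const_mul 9
  rw [mul_zero] at h9
  refine h9.congr fun n => ?_
  rw [measureReal_def, exteriorMeasure_univ hs, ENNReal.toReal_ofReal]
  exact mul_nonneg (by norm_num) (tsum_nonneg fun _ => measureReal_nonneg)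

instance (k : ℕ) : IsFiniteMeasure (exteriorLayer E k) := by
  unfold exteriorLayer; infer_instance

/-- Some `e ∈ E` lies within `ε` of `θ`. Over the arc of radius `ε` about `e`, of length `2ε`, the
kernel is at least `2ε / (3ε)² = 2 / (9ε)`. -/
theorem le_integral_exteriorLayer (hE : IsClosed E) (hE0 : E.Nonempty) {θ : UnitCircle} (hθ : θ ∉ E)
    {k : ℕ} (hk : Metric.infDist θ E < (1 / 2) ^ k) :
    4 / 9 ≤ ∫ w, ((w + θ.toCircle) / (w - θ.toCircle)).re ∂(exteriorLayer E k) := by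
  have hcar := carriedNear_exteriorLayer (E := E) k
  have hint : Integrable (fun w : ℂ => ((w + θ.toCircle) / (w - θ.toCircle)).re)
      (exteriorLayer E k) :=
    (hcar.integrable_kernel (norm_toCircle θ).le (infDist_circleImage_pos hE hE0 hθ)).re
  have hnonneg : ∀ᵐ w ∂(exteriorLayer E k), 0 ≤ ((w + θ.toCircle) / (w - θ.toCircle)).re := by
    filter_upwards [hcar] with w hw
    rw [re_herglotz_kernel, norm_toCircle]
    have : 1 ≤ ‖w‖ ^ 2 := one_le_pow₀ hw.1
    exact div_nonneg (by linarith) (by positivity)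
  have hm := (measurable_const_mul_toCircle ((1 + (1 / 2) ^ k : ℝ) : ℂ))
  unfold exteriorLayer at hint hnonneg ⊢
  rw [integral_map hm.aemeasurable hint.1]
  have hint2 := (integrable_map_measure hint.1 hm.aemeasurable).1 hint
  have hnn2 := ae_of_ae_map hm.aemeasurable hnonneg
  obtain ⟨e, he, hde⟩ := (Metric.infDist_lt_iff hE0).1 hk
  set ε : ℝ := (1 / 2) ^ k with hεdef
  have hε0 : 0 < ε := by positivity
  have hε1 : ε ≤ 1 := pow_le_one₀ (by norm_num) (by norm_num)
  have hsub : Metric.ball e ε ⊆ Metric.thickening ε E := fun t ht =>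
    Metric.mem_thickening_iff.2 ⟨e, he, ht⟩
  have hvol : volume.real (Metric.ball e ε) = 2 * ε := by
    rw [measureReal_def, measure_congr (AddCircle.closedBall_ae_eq_ball (x := e) (ε := ε)).symm,
      AddCircle.volume_closedBall, ENNReal.toReal_ofReal, min_eq_right]
    · linarith [Real.pi_gt_three]
    · have := Real.pi_pos; positivity
  have hlow : ∀ t ∈ Metric.ball e ε, 2 / (9 * ε) ≤
      ((((1 + ε : ℝ) : ℂ) * t.toCircle + θ.toCircle)
        / (((1 + ε : ℝ) : ℂ) * t.toCircle - θ.toCircle)).re := fun t ht => by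
    have h1 : ‖((1 + ε : ℝ) : ℂ) * t.toCircle‖ = 1 + ε := by
      rw [norm_mul, norm_toCircle, mul_one, Complex.norm_real, Real.norm_of_nonneg (by positivity)]
    have h2 : ‖((1 + ε : ℝ) : ℂ) * t.toCircle - θ.toCircle‖ ≤ 3 * ε := by
      have e1 : ((1 + ε : ℝ) : ℂ) * t.toCircle - θ.toCircle
        = (ε : ℂ) * t.toCircle + (t.toCircle - θ.toCircle) := by push_cast; ring
      rw [e1]
      refine (norm_add_le _ _).trans ?_
      rw [norm_mul, norm_toCircle, mul_one, Complex.norm_real, Real.norm_of_nonneg hε0.le]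
      have h3 := norm_toCircle_sub_le t θ
      have h4 := dist_triangle t e θ
      rw [Metric.mem_ball] at ht
      rw [dist_comm e θ] at h4
      linarith
    have h3 : ε ≤ ‖((1 + ε : ℝ) : ℂ) * t.toCircle - θ.toCircle‖ := by
      have := norm_sub_norm_le (((1 + ε : ℝ) : ℂ) * t.toCircle) (θ.toCircle : ℂ)
      rw [h1, norm_toCircle] at this
      linarith
    rw [re_herglotz_kernel, h1, norm_toCircle]
    rw [div_le_div_iff₀ (by positivity) (by have := hε0.trans_le h3; positivity)]
    nlinarith [sq_nonneg ε, mul_pos hε0 hε0]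
  calc (4 / 9 : ℝ) = ∫ _ in Metric.ball e ε, 2 / (9 * ε) ∂(volume : Measure UnitCircle) := by
        rw [setIntegral_const, hvol, smul_eq_mul]; field_simp; norm_num
    _ ≤ ∫ t in Metric.ball e ε, ((((1 + ε : ℝ) : ℂ) * t.toCircle + θ.toCircle)
        / (((1 + ε : ℝ) : ℂ) * t.toCircle - θ.toCircle)).re ∂(volume : Measure UnitCircle) :=
      setIntegral_mono_on (integrable_const _) (IntegrableOn.mono_set hint2 hsub)
        Metric.isOpen_ball.measurableSet hlow
    _ ≤ _ := setIntegral_mono_set hint2 hnn2 hsub.eventuallyLE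

/-- Each of the `j` layers wider than the distance to `E` contributes `9 · 4/9 = 4`; the others
contribute nonnegatively. -/
theorem le_re_herglotz_exteriorMeasure (hE : IsClosed E) (hE0 : E.Nonempty)
    (hs : Summable fun k : ℕ => volume.real (Metric.thickening ((1 / 2) ^ k) E))
    {θ : UnitCircle} (hθ : θ ∉ E) {n j : ℕ}
    (hj : ∀ k < j, Metric.infDist θ E < (1 / 2) ^ (n + k)) :
    4 * (j : ℝ) ≤ (herglotz (exteriorMeasure E n) θ.toCircle).re := by
  have := isFiniteMeasure_exteriorMeasure hs n
  have hpos := infDist_circleImage_pos hE hE0 hθ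
  have hint := (carriedNear_exteriorMeasure (E := E) n).integrable_kernel (norm_toCircle θ).le hpos
  rw [herglotz, ← RCLike.re_eq_complex_re, ← integral_re hint]
  have hint' := hint.re
  have hnn : ∀ k, 0 ≤ ∫ w, RCLike.re ((w + θ.toCircle) / (w - θ.toCircle))
      ∂((9 : ℝ≥0∞) • exteriorLayer E (n + k)) := fun k => by
    rw [integral_re]
    · exact re_herglotz_nonneg (K := circleImage E)
        (Measure.ae_smul_measure (carriedNear_exteriorLayer (n + k)) _) (norm_toCircle θ).le
    · exact hint.mono_measure (Measure.le_sum _ k)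
  unfold exteriorMeasure at hint' ⊢
  have hsum := hasSum_integral_measure hint'
  refine le_trans ?_ (sum_le_hasSum (Finset.range j) (fun k _ => hnn k) hsum)
  calc 4 * (j : ℝ) = ∑ k ∈ Finset.range j, (4 : ℝ) := by simp [mul_comm]
    _ ≤ _ := Finset.sum_le_sum fun k hk => by
      rw [integral_smul_measure]
      have := le_integral_exteriorLayer hE hE0 hθ (hj k (Finset.mem_range.1 hk))
      simp only [RCLike.re_eq_complex_re, smul_eq_mul, ENNReal.toReal_ofNat]
      linarith

/-- About `log₂ (1 / (2ⁿ d))` layers reach `θ`, each giving a factor `exp (-4) ≤ (1/2)²`, whence the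
exponent `2`. The constant may depend on `n`, since `n → ∞` is taken only after the integrals are
known to vanish. -/
theorem norm_exp_neg_herglotz_exteriorMeasure_le (hE : IsClosed E) (hE0 : E.Nonempty)
    (hs : Summable fun k : ℕ => volume.real (Metric.thickening ((1 / 2) ^ k) E))
    {θ : UnitCircle} (hθ : θ ∉ E) (n : ℕ) :
    ‖Complex.exp (-herglotz (exteriorMeasure E n) θ.toCircle)‖
      ≤ (4 * (2 ^ n) ^ 2) * Metric.infDist θ E ^ 2 := by
  have hd : 0 < Metric.infDist θ E := (hE.notMem_iff_infDist_pos hE0).1 hθ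
  set d := Metric.infDist θ E
  have h2 : (0 : ℝ) < 2 ^ n := by positivity
  obtain hge | hlt := le_or_gt 1 (2 ^ n * d)
  · refine (norm_exp_neg_herglotz_le_one (carriedNear_exteriorMeasure n) (norm_toCircle θ).le).trans ?_
    nlinarith
  · obtain ⟨j, hj1, hj2⟩ := exists_nat_pow_near_of_lt_one (x := 2 ^ n * d) (y := 1 / 2)
      (by positivity) hlt.le (by norm_num) (by norm_num)
    have hcount : ∀ k < j, d < (1 / 2) ^ (n + k) := fun k hk => by
      have h3 : (1 / 2 : ℝ) ^ j ≤ (1 / 2) ^ (k + 1) :=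
        pow_le_pow_of_le_one (by norm_num) (by norm_num) hk
      have h4 : (0 : ℝ) < (1 / 2) ^ k := by positivity
      have h5 : 2 ^ n * d < (1 / 2) ^ k := by rw [pow_succ] at h3; linarith
      have h6 : (1 / 2 : ℝ) ^ n * 2 ^ n = 1 := by rw [← mul_pow]; norm_num
      calc d = (1 / 2 : ℝ) ^ n * (2 ^ n * d) := by rw [← mul_assoc, h6, one_mul]
        _ < (1 / 2 : ℝ) ^ n * (1 / 2) ^ k := by gcongr
        _ = _ := (pow_add _ _ _).symm
    have hre := le_re_herglotz_exteriorMeasure hE hE0 hs hθ hcount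
    rw [Complex.norm_exp, Complex.neg_re]
    have h7 : Real.exp (-4) ≤ (1 / 2) ^ 2 := by
      rw [Real.exp_neg]
      have := Real.add_one_le_exp (4 : ℝ)
      rw [inv_le_comm₀ (Real.exp_pos _) (by norm_num)]
      linarith
    calc Real.exp _ ≤ Real.exp ((j : ℝ) * (-4)) := Real.exp_le_exp.2 (by linarith)
      _ = Real.exp (-4) ^ j := Real.exp_nat_mul _ _
      _ ≤ ((1 / 2) ^ 2) ^ j := by gcongr
      _ = 4 * ((1 / 2) ^ (j + 1)) ^ 2 := by rw [← pow_mul, ← pow_mul]; ring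
      _ ≤ 4 * (2 ^ n * d) ^ 2 := by gcongr
      _ = _ := by ring

end

/-! ### Non-cyclicity of `S`. -/

section

variable {E : Set UnitCircle} (μ : Measure UnitCircle)

/-- A measure on the circle, seen as a measure on the complex plane. -/
noncomputable def planeMeasure : Measure ℂ := μ.map fun θ => (θ.toCircle : ℂ)

instance [IsFiniteMeasure μ] : IsFiniteMeasure (planeMeasure μ) := by
  unfold planeMeasure; infer_instance

theorem singularInner_eq_exp_herglotz (z : ℂ) :
    singularInner μ z = Complex.exp (-herglotz (planeMeasure μ) z) := by
  rw [singularInner, herglotz, planeMeasure, integral_map continuous_coe_toCircle.aemeasurable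
    (aestronglyMeasurable_herglotz_kernel z)]

variable {μ}

theorem ae_planeMeasure_mem (hE : IsClosed E) (hμ : μ Eᶜ = 0) :
    ∀ᵐ w ∂(planeMeasure μ), w ∈ circleImage E := by
  refine (ae_map_iff (p := fun w => w ∈ circleImage E) continuous_coe_toCircle.aemeasurable
    (isClosed_circleImage hE).measurableSet).2 ?_
  have : ∀ᵐ θ ∂μ, θ ∈ E := hμ
  filter_upwards [this] with θ hθ using ⟨θ, hθ, rfl⟩

theorem ae_planeMeasure_norm : ∀ᵐ w ∂(planeMeasure μ), ‖w‖ = 1 := by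
  rw [planeMeasure, ae_map_iff continuous_coe_toCircle.aemeasurable
    (measurableSet_eq_fun measurable_norm measurable_const)]
  exact ae_of_all _ norm_toCircle

theorem carriedNear_planeMeasure (hE : IsClosed E) (hμ : μ Eᶜ = 0) :
    CarriedNear (planeMeasure μ) (circleImage E) := by
  filter_upwards [ae_planeMeasure_mem hE hμ, ae_planeMeasure_norm] with w hw hw1
  refine ⟨hw1.ge, by linarith, fun z _ => ?_⟩
  have := Metric.infDist_le_dist_of_mem (x := z) hw
  rw [dist_eq_norm, norm_sub_rev] at this
  linarith [norm_nonneg (w - z)]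

theorem volume_eq_zero_of_summable_thickening
    (hs : Summable fun k : ℕ => volume.real (Metric.thickening ((1 / 2) ^ k) E)) :
    volume E = 0 := by
  have h0 : volume.real E ≤ 0 := ge_of_tendsto' hs.tendsto_atTop_zero fun k =>
    measureReal_mono (Metric.self_subset_thickening (by positivity) E)
  exact (measureReal_eq_zero_iff).1 (le_antisymm h0 measureReal_nonneg)

theorem not_isCyclicEllpA_singularInner [IsFiniteMeasure μ] (hμ0 : μ ≠ 0) (hE : IsClosed E)
    (hE0 : E.Nonempty)
    (hs : Summable fun k : ℕ => volume.real (Metric.thickening ((1 / 2) ^ k) E))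
    (hμ : μ Eᶜ = 0) {p : ℝ} (hp : 0 < p) : ¬ IsCyclicEllpA p (singularInner μ) := by
  intro hcyc
  rw [funext (singularInner_eq_exp_herglotz μ)] at hcyc
  set κ := planeMeasure μ
  have hκ : CarriedNear κ (circleImage E) := carriedNear_planeMeasure hE hμ
  have hκ1 : ∀ᵐ w ∂κ, ‖w‖ = 1 := ae_planeMeasure_norm
  have hE00 := volume_eq_zero_of_summable_thickening hs
  have hae := ae_haar_notMem hE00
  have hfin := isFiniteMeasure_exteriorMeasure hs
  set S : ℂ → ℂ := fun z => Complex.exp (-herglotz κ z) with hSdef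
  have hSd : DifferentiableOn ℂ S (Metric.ball 0 1) :=
    (hκ.differentiableOn_herglotz (isClosed_circleImage hE) (hE0.image _)
      circleImage_subset_sphere).neg.cexp
  have hSb : ∀ z : ℂ, ‖z‖ < 1 → ‖S z‖ ≤ 1 := fun z hz => norm_exp_neg_herglotz_le_one hκ hz.le
  have hScont : ∀ θ : UnitCircle, θ ∉ E → ContinuousAt S θ.toCircle := fun θ hθ =>
    (hκ.hasDerivAt_herglotz (norm_toCircle θ).le
      (infDist_circleImage_pos hE hE0 hθ)).continuousAt.neg.cexp
  have hSn : ∀ θ : UnitCircle, ‖S θ.toCircle‖ = 1 := fun θ => by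
    rw [hSdef, Complex.norm_exp, Complex.neg_re, re_herglotz_eq_zero hκ1 (norm_toCircle θ)]
    simp
  have hconj : ∀ θ : UnitCircle,
      Complex.exp (herglotz κ θ.toCircle) = (starRingEnd ℂ) (S θ.toCircle) := fun θ => by
    have h1 : S θ.toCircle * Complex.exp (herglotz κ θ.toCircle) = 1 := by
      rw [hSdef, ← Complex.exp_add]; simp
    have h2 : S θ.toCircle * (starRingEnd ℂ) (S θ.toCircle) = 1 := by
      rw [Complex.mul_conj, Complex.normSq_eq_norm_sq, hSn]; simp
    exact mul_left_cancel₀ (Complex.exp_ne_zero _) (h1.trans h2.symm)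
  -- The exterior masses tend to `0`, so `exp (-H ν_n) → 1` off `E`, dominated by `1`.
  have hmom : ∀ m : ℕ, m ≠ 0 → ∫ θ : UnitCircle, (θ.toCircle : ℂ) ^ m *
      Complex.exp (herglotz κ θ.toCircle) ∂haarAddCircle = 0 := fun m hm => by
    have hz : ∀ n, ∫ θ : UnitCircle, (θ.toCircle : ℂ) ^ m *
        Complex.exp (-herglotz (exteriorMeasure E n) θ.toCircle + herglotz κ θ.toCircle)
        ∂haarAddCircle = 0 := fun n =>
      integral_eq_zero_of_cyclic hm (by positivity) hE hE0 hE00 (carriedNear_exteriorMeasure n)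
        hκ hκ1 (fun θ hθ => norm_exp_neg_herglotz_exteriorMeasure_le hE hE0 hs hθ n) hp hcyc
    refine tendsto_nhds_unique (tendsto_integral_of_dominated_convergence (fun _ => (1 : ℝ))
      (fun n => ?_) (integrable_const _) (fun n => ae_of_all _ fun θ => ?_) ?_)
      (tendsto_const_nhds.congr fun n => (hz n).symm)
    · have h1 := (measurable_herglotz (exteriorMeasure E n)).comp continuous_coe_toCircle.measurable
      have h2 := (measurable_herglotz κ).comp continuous_coe_toCircle.measurable
      exact ((continuous_coe_toCircle.pow m).measurable.mul
        (h1.neg.add h2).cexp).aestronglyMeasurable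
    · rw [Complex.exp_add, norm_mul, norm_mul, norm_pow, norm_toCircle, one_pow, one_mul, hconj,
        RCLike.norm_conj, hSn, mul_one]
      exact norm_exp_neg_herglotz_le_one (carriedNear_exteriorMeasure n) (norm_toCircle θ).le
    · filter_upwards [hae] with θ hθ
      have hpos := infDist_circleImage_pos hE hE0 hθ
      have h0 : Tendsto (fun n => herglotz (exteriorMeasure E n) θ.toCircle) atTop (𝓝 0) := by
        refine squeeze_zero_norm (fun n =>
          (carriedNear_exteriorMeasure n).norm_herglotz_le (norm_toCircle θ).le hpos) ?_
        simpa using (tendsto_exteriorMeasure_univ hs).const_mul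
          (9 / Metric.infDist (θ.toCircle : ℂ) (circleImage E))
      have h1 := (((h0.neg.add_const (herglotz κ θ.toCircle)).cexp).const_mul
        ((θ.toCircle : ℂ) ^ m))
      simpa using h1
  -- On the circle `exp (H κ) = conj S`, so the vanishing integrals are the conjugates of the
  -- coefficients of `S`.
  have hcoef : ∀ m : ℕ, m ≠ 0 → maclaurinCoeff S m = 0 := fun m hm => by
    have hc : Continuous fun θ : UnitCircle => (starRingEnd ℂ) ((θ.toCircle : ℂ) ^ m) :=
      Complex.continuous_conj.comp (continuous_coe_toCircle.pow m)
    have h1 := tendsto_integral_radial hSd hSb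
      (by filter_upwards [hae] with θ hθ using hScont θ hθ)
      (hc.integrable_of_hasCompactSupport (HasCompactSupport.of_compactSpace _))
    have h2 : ∫ θ : UnitCircle, S θ.toCircle * (starRingEnd ℂ) ((θ.toCircle : ℂ) ^ m)
        ∂haarAddCircle = 0 := by
      have h3 := congrArg (starRingEnd ℂ) (hmom m hm)
      rw [← integral_conj, map_zero] at h3
      rw [← h3]
      refine integral_congr_ae (ae_of_all _ fun θ => ?_)
      simp only [map_mul, hconj, Complex.conj_conj, mul_comm]
    rw [h2] at h1
    have h4 : Tendsto (fun r : ℝ => maclaurinCoeff S m * (r : ℂ) ^ m) (𝓝[<] 1)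
        (𝓝 (maclaurinCoeff S m * ((1 : ℝ) : ℂ) ^ m)) :=
      (Continuous.tendsto (by fun_prop) 1).mono_left nhdsWithin_le_nhds
    have h5 : Tendsto (fun r : ℝ => maclaurinCoeff S m * (r : ℂ) ^ m) (𝓝[<] 1) (𝓝 0) := by
      refine h1.congr' ?_
      filter_upwards [Ioo_mem_nhdsLT (show (0 : ℝ) < 1 by norm_num)] with r hr
      exact integral_mul_conj_pow hSd hr.1.le hr.2 m
    simpa using tendsto_nhds_unique h4 h5
  have hconst : ∀ z : ℂ, ‖z‖ < 1 → S z = S 0 := fun z hz => by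
    have h1 := hasSum_maclaurinCoeff hSd hz
    have h2 : HasSum (fun k => maclaurinCoeff S k * z ^ k) (maclaurinCoeff S 0 * z ^ 0) :=
      hasSum_single 0 fun k hk => by rw [hcoef k hk, zero_mul]
    rw [h1.unique h2]
    simp [maclaurinCoeff]
  -- One boundary point off `E`, where `S` is continuous and unimodular, suffices for `|S 0| = 1`.
  obtain ⟨θ, hθ⟩ := hae.exists
  have h1 : Tendsto (fun r : ℝ => S (r * θ.toCircle)) (𝓝[<] 1) (𝓝 (S θ.toCircle)) := by
    refine (hScont θ hθ).tendsto.comp ?_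
    have : Tendsto (fun r : ℝ => (r : ℂ) * θ.toCircle) (𝓝 1) (𝓝 (((1 : ℝ) : ℂ) * θ.toCircle)) :=
      Continuous.tendsto (by fun_prop) 1
    rw [Complex.ofReal_one, one_mul] at this
    exact this.mono_left nhdsWithin_le_nhds
  have h2 : S θ.toCircle = S 0 := by
    refine tendsto_nhds_unique h1 (tendsto_const_nhds.congr' ?_)
    filter_upwards [Ioo_mem_nhdsLT (show (0 : ℝ) < 1 by norm_num)] with r hr
    exact (hconst _ (by simpa [abs_of_pos hr.1] using hr.2)).symm
  have h3 : ‖S 0‖ = Real.exp (-μ.real Set.univ) := by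
    have h5 : herglotz κ 0 = (μ.real Set.univ : ℂ) := by
      have h6 : herglotz κ 0 = ∫ w, (1 : ℂ) ∂κ := by
        refine integral_congr_ae ?_
        filter_upwards [hκ1] with w hw
        have : w ≠ 0 := by rintro rfl; simp at hw
        simp [this]
      rw [h6, integral_const, Complex.real_smul, mul_one]
      congr 1
      rw [measureReal_def, measureReal_def]
      simp only [κ, planeMeasure]
      rw [Measure.map_apply continuous_coe_toCircle.measurable MeasurableSet.univ, Set.preimage_univ]
    change ‖Complex.exp (-herglotz κ 0)‖ = _
    rw [h5, Complex.norm_exp]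
    simp
  have h4 := hSn θ
  rw [h2, h3, Real.exp_eq_one_iff, neg_eq_zero, measureReal_eq_zero_iff] at h4
  exact hμ0 (Measure.measure_univ_eq_zero.1 h4)

end

/-! ### Summable neighbourhoods imply the Beurling–Carleson condition. -/

/-- The component of the `n`-th point of a dense sequence is kept only if no earlier point lies in
it, and is replaced by `∅` otherwise, so each component occurs once. -/
theorem exists_pairwise_disjoint_components {X : Type*} [TopologicalSpace X]
    [TopologicalSpace.SeparableSpace X] [Nonempty X] [LocallyConnectedSpace X] {U : Set X}
    (hU : IsOpen U) :
    ∃ I : ℕ → Set X, (∀ n, IsOpen (I n) ∧ IsPreconnected (I n)) ∧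
      Pairwise (fun m n => Disjoint (I m) (I n)) ∧ (⋃ n, I n) = U ∧
      ∀ n, ∀ x ∈ I n, I n = connectedComponentIn U x := by
  classical
  set d := TopologicalSpace.denseSeq X
  set I : ℕ → Set X := fun n =>
    if ∀ m < n, d m ∉ connectedComponentIn U (d n) then connectedComponentIn U (d n) else ∅
    with hI
  have hmem : ∀ {n x}, x ∈ I n →
      (∀ m < n, d m ∉ connectedComponentIn U (d n)) ∧ x ∈ connectedComponentIn U (d n) := by
    intro n x hx
    simp only [hI] at hx
    split_ifs at hx with h
    · exact ⟨h, hx⟩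
    · exact hx.elim
  have hcomp : ∀ n, ∀ x ∈ I n, I n = connectedComponentIn U x := fun n x hx => by
    obtain ⟨h1, h2⟩ := hmem hx
    rw [← connectedComponentIn_eq h2]
    exact if_pos h1
  have hlt : ∀ m n, m < n → Disjoint (I m) (I n) := fun m n hmn => by
    rw [Set.disjoint_left]
    intro x hm hn
    obtain ⟨-, h2⟩ := hmem hm
    obtain ⟨h3, h4⟩ := hmem hn
    refine h3 m hmn ?_
    rw [connectedComponentIn_eq h4, ← connectedComponentIn_eq h2]
    exact mem_connectedComponentIn (connectedComponentIn_nonempty_iff.1 ⟨x, h2⟩)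
  refine ⟨I, fun n => ?_, fun m n hmn => ?_, ?_, hcomp⟩
  · simp only [hI]
    split_ifs
    · exact ⟨hU.connectedComponentIn, isPreconnected_connectedComponentIn⟩
    · exact ⟨isOpen_empty, isPreconnected_empty⟩
  · exact (lt_or_gt_of_ne hmn).elim (hlt m n) fun h => (hlt n m h).symm
  · refine Set.Subset.antisymm (Set.iUnion_subset fun n x hx =>
      connectedComponentIn_subset _ _ (hmem hx).2) fun x hx => ?_
    have hex : ∃ n, d n ∈ connectedComponentIn U x := by
      obtain ⟨y, hy, n, rfl⟩ := (TopologicalSpace.denseRange_denseSeq X).inter_open_nonempty _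
        hU.connectedComponentIn ⟨x, mem_connectedComponentIn hx⟩
      exact ⟨n, hy⟩
    have heq := connectedComponentIn_eq (Nat.find_spec hex)
    refine Set.mem_iUnion.2 ⟨Nat.find hex, ?_⟩
    have : I (Nat.find hex) = connectedComponentIn U (d (Nat.find hex)) := by
      refine if_pos fun m hm => ?_
      rw [← heq]
      exact Nat.find_min hex hm
    rw [this, ← heq]
    exact mem_connectedComponentIn hx

instance : LocallyConnectedSpace UnitCircle :=
  (QuotientAddGroup.isQuotientMap_mk (AddSubgroup.zmultiples (2 * π))).isCoinducing.locallyConnectedSpace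

/-- The arc of radius `r` about `y` is connected and misses `E`, so the component has length at
least `2 * r`. -/
theorem infDist_le_volume_component {E : Set UnitCircle} (hE : IsClosed E) (hE0 : E.Nonempty)
    (y : UnitCircle) (hy : y ∉ E) :
    Metric.infDist y E ≤ volume.real (connectedComponentIn Eᶜ y) := by
  set r := Metric.infDist y E
  have hr : 0 < r := (hE.notMem_iff_infDist_pos hE0).1 hy
  have hrπ : r ≤ π := by
    obtain ⟨e, he⟩ := hE0
    refine (Metric.infDist_le_dist_of_mem he).trans ?_
    rw [dist_eq_norm]
    refine (AddCircle.norm_le_half_period _ Real.two_pi_pos.ne').trans ?_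
    rw [abs_of_pos Real.two_pi_pos]; linarith
  obtain ⟨x, hx⟩ : ∃ x : ℝ, (x : UnitCircle) = y := QuotientAddGroup.mk_surjective y
  set s : Set UnitCircle := (fun t : ℝ => (t : UnitCircle)) '' Metric.ball x r
  have hsc : IsPreconnected s :=
    (convex_ball x r).isPreconnected.image _ (AddCircle.continuous_mk' _).continuousOn
  have hsx : y ∈ s := ⟨x, Metric.mem_ball_self hr, hx⟩
  have hball : Metric.ball y r ⊆ s := fun z hz => by
    obtain ⟨t, ht, ht'⟩ := exists_coe_eq_abs_eq_norm (z - y)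
    refine ⟨t + x, ?_, ?_⟩
    · rw [Metric.mem_ball, dist_eq_norm] at hz ⊢
      rwa [add_sub_cancel_right, Real.norm_eq_abs, ht']
    · simp only [AddCircle.coe_add, ht, hx, sub_add_cancel]
  have hsE : s ⊆ Eᶜ := by
    rintro _ ⟨t, ht, rfl⟩ hte
    have h1 := Metric.infDist_le_dist_of_mem (x := y) hte
    rw [← hx, dist_eq_norm, ← AddCircle.coe_sub] at h1
    rw [Metric.mem_ball, dist_comm, Real.dist_eq] at ht
    have h2 : ‖((x - t : ℝ) : UnitCircle)‖ ≤ |x - t| := by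
      refine ((AddCircle.norm_coe_eq_abs_iff _ Real.two_pi_pos.ne').2 ?_).le
      rw [abs_of_pos Real.two_pi_pos]; linarith
    rw [hx] at h1
    linarith
  have hsub := hsc.subset_connectedComponentIn hsx hsE
  have hvol : volume.real (Metric.ball y r) = 2 * r := by
    rw [measureReal_def, measure_congr (AddCircle.closedBall_ae_eq_ball (x := _) (ε := r)).symm,
      AddCircle.volume_closedBall, ENNReal.toReal_ofReal, min_eq_right]
    · linarith
    · have := Real.pi_pos; positivity
  have := measureReal_mono (μ := volume) (hball.trans hsub)
  rw [hvol] at this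
  linarith

/-- Whenever `(1/2)^k` exceeds the length of `I`, the whole of `I` lies in the `k`-th neighbourhood;
there are about `log₂ (1 / |I|)` such `k`. The constant `8 ≥ 2π` takes care of arcs longer than `1`.
-/
theorem abs_mul_log_le {E I : Set UnitCircle}
    (hs : Summable fun k : ℕ => volume.real (Metric.thickening ((1 / 2) ^ k) E))
    (hE0 : E.Nonempty) (hI : ∀ y ∈ I, Metric.infDist y E ≤ volume.real I) :
    |volume.real I * Real.log (1 / volume.real I)| ≤ 8 * volume.real I +
      ∑' k : ℕ, volume.real (I ∩ Metric.thickening ((1 / 2) ^ k) E) := by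
  have hsum : Summable fun k : ℕ => volume.real (I ∩ Metric.thickening ((1 / 2) ^ k) E) :=
    hs.of_nonneg_of_le (fun _ => measureReal_nonneg)
      fun k => measureReal_mono Set.inter_subset_right
  have hnn : 0 ≤ ∑' k : ℕ, volume.real (I ∩ Metric.thickening ((1 / 2) ^ k) E) :=
    tsum_nonneg fun _ => measureReal_nonneg
  have hterm0 : ∀ k : ℕ, volume.real I < (1 / 2) ^ k →
      volume.real (I ∩ Metric.thickening ((1 / 2) ^ k) E) = volume.real I := fun k hk => by
    congr 1
    exact Set.inter_eq_left.2 fun y hy =>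
      Metric.mem_thickening_iff.2 ((Metric.infDist_lt_iff hE0).1 ((hI y hy).trans_lt hk))
  clear hI
  set l := volume.real I
  obtain h0 | h0 := (measureReal_nonneg : 0 ≤ l).eq_or_lt
  · have h1 : l = 0 := h0.symm
    rw [h1]; simpa using hnn
  have hl7 : l ≤ 8 := by
    have h1 : l ≤ volume.real (Set.univ : Set UnitCircle) := measureReal_mono (Set.subset_univ _)
    rw [measureReal_def, AddCircle.measure_univ, ENNReal.toReal_ofReal Real.two_pi_pos.le] at h1
    linarith [Real.pi_le_four]
  rw [one_div, Real.log_inv, abs_mul, abs_neg, abs_of_pos h0]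
  obtain h1 | h1 := le_or_gt 1 l
  · rw [abs_of_nonneg (Real.log_nonneg h1)]
    have := Real.log_le_self h0.le
    nlinarith
  · obtain ⟨j, hj1, hj2⟩ := exists_nat_pow_near_of_lt_one (x := l) (y := 1 / 2)
      h0 h1.le (by norm_num) (by norm_num)
    have hterm : ∀ k ∈ Finset.range j,
        l ≤ volume.real (I ∩ Metric.thickening ((1 / 2) ^ k) E) := fun k hk => by
      have h3 : (1 / 2 : ℝ) ^ j ≤ (1 / 2) ^ (k + 1) :=
        pow_le_pow_of_le_one (by norm_num) (by norm_num) (Finset.mem_range.1 hk)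
      have h4 : (0 : ℝ) < (1 / 2) ^ k := by positivity
      rw [pow_succ] at h3
      exact (hterm0 k (by linarith)).ge
    have h6 : (j : ℝ) * l ≤ ∑' k : ℕ, volume.real (I ∩ Metric.thickening ((1 / 2) ^ k) E) := by
      refine le_trans ?_ (hsum.sum_le_tsum (Finset.range j) fun _ _ => measureReal_nonneg)
      calc (j : ℝ) * l = ∑ k ∈ Finset.range j, l := by simp
        _ ≤ _ := Finset.sum_le_sum hterm
    have h7 : -Real.log l ≤ j + 1 := by
      have h8 := Real.log_le_log (by positivity) hj1.le
      rw [Real.log_pow, one_div, Real.log_inv] at h8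
      have h9 : Real.log 2 ≤ 1 := by linarith [Real.log_two_lt_d9]
      have h10 : Real.log 2 * ((j + 1 : ℕ) : ℝ) ≤ 1 * ((j + 1 : ℕ) : ℝ) := by gcongr
      push_cast at h8 h10
      linarith
    rw [abs_of_nonpos (Real.log_nonpos h0.le h1.le)]
    nlinarith

theorem isBeurlingCarleson_of_summable_thickening {E : Set UnitCircle} (hE : IsClosed E)
    (hE0 : E.Nonempty)
    (hs : Summable fun k : ℕ => volume.real (Metric.thickening ((1 / 2) ^ k) E)) :
    IsBeurlingCarleson E := by
  obtain ⟨I, hI, hdisj, hU, hcomp⟩ := exists_pairwise_disjoint_components hE.isOpen_compl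
  refine ⟨hE, volume_eq_zero_of_summable_thickening hs, I, hI, hdisj, hU, ?_⟩
  have hle : ∀ n, |volume.real (I n) * Real.log (1 / volume.real (I n))| ≤ 8 * volume.real (I n) +
      ∑' k : ℕ, volume.real (I n ∩ Metric.thickening ((1 / 2) ^ k) E) := fun n =>
    abs_mul_log_le hs hE0 fun y hy => by
      have hyU : y ∈ Eᶜ := by rw [← hU]; exact Set.mem_iUnion_of_mem n hy
      rw [hcomp n y hy]
      exact infDist_le_volume_component hE hE0 y hyU
  have hsum : ∀ n, Summable fun k : ℕ => volume.real (I n ∩ Metric.thickening ((1 / 2) ^ k) E) :=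
    fun n => hs.of_nonneg_of_le (fun _ => measureReal_nonneg)
      fun k => measureReal_mono Set.inter_subset_right
  have hmeas : ∀ (N : ℕ) (A : Set UnitCircle), MeasurableSet A →
      ∑ n ∈ Finset.range N, volume.real (I n ∩ A) ≤ volume.real A := fun N A hA => by
    rw [← measureReal_biUnion_finset]
    · exact measureReal_mono (Set.iUnion₂_subset fun _ _ => Set.inter_subset_right)
    · exact fun m _ n _ hmn => (hdisj hmn).mono Set.inter_subset_left Set.inter_subset_left
    · exact fun n _ => (hI n).1.measurableSet.inter hA
  refine Summable.of_norm_bounded (g := fun n => 8 * volume.real (I n) +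
      ∑' k : ℕ, volume.real (I n ∩ Metric.thickening ((1 / 2) ^ k) E)) ?_ hle
  refine summable_of_sum_range_le (c := 8 * volume.real (Set.univ : Set UnitCircle) +
    ∑' k : ℕ, volume.real (Metric.thickening ((1 / 2) ^ k) E))
    (fun n => add_nonneg (by positivity) (tsum_nonneg fun _ => measureReal_nonneg)) fun N => ?_
  rw [Finset.sum_add_distrib, ← Finset.mul_sum, ← Summable.tsum_finsetSum fun n _ => hsum n]
  gcongr
  · simpa using hmeas N Set.univ MeasurableSet.univ
  · exact summable_sum fun n _ => hsum n
  · exact hmeas N _ Metric.isOpen_thickening.measurableSet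

/-! ### Digit means and the `ℓ^p` bound. -/

/-- The character `x ↦ e^{-2πix}` of `ℝ / ℤ`. -/
noncomputable def unitChar (x : ℝ) : ℂ := Complex.exp (-(2 * π * x : ℝ) * Complex.I)

/-- The Fourier transform of the uniform probability measure on `{0, …, K - 1}`. -/
noncomputable def digitMean (K : ℕ) (x : ℝ) : ℂ := (∑ d ∈ Finset.range K, unitChar (d * x)) / K

theorem unitChar_add (x y : ℝ) : unitChar (x + y) = unitChar x * unitChar y := by
  rw [unitChar, unitChar, unitChar, ← Complex.exp_add]
  congr 1; push_cast; ring

theorem norm_unitChar (x : ℝ) : ‖unitChar x‖ = 1 := by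
  rw [unitChar, ← Complex.ofReal_neg, Complex.norm_exp_ofReal_mul_I]

theorem unitChar_eq_one_iff {x : ℝ} : unitChar x = 1 ↔ ∃ n : ℤ, x = n := by
  rw [unitChar, Complex.exp_eq_one_iff]
  have hpi : (π : ℂ) ≠ 0 := Complex.ofReal_ne_zero.2 Real.pi_ne_zero
  constructor
  · rintro ⟨n, hn⟩
    refine ⟨-n, ?_⟩
    have h2 : (2 * π * Complex.I) * ((x : ℂ) + n) = 0 := by
      push_cast at hn; linear_combination -hn
    have h3 := (mul_eq_zero.1 h2).resolve_left Complex.two_pi_I_ne_zero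
    have : (x : ℂ) = ((-n : ℤ) : ℝ) := by push_cast; linear_combination h3
    exact_mod_cast this
  · rintro ⟨n, rfl⟩
    exact ⟨-n, by push_cast; ring⟩

theorem unitChar_intCast (n : ℤ) : unitChar n = 1 := unitChar_eq_one_iff.2 ⟨n, rfl⟩

theorem unitChar_zero : unitChar 0 = 1 := by simpa using unitChar_intCast 0

theorem conj_unitChar (x : ℝ) : (starRingEnd ℂ) (unitChar x) = unitChar (-x) := by
  rw [unitChar, unitChar, ← Complex.exp_conj]
  rw [map_mul, map_neg, Complex.conj_ofReal, Complex.conj_I]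
  push_cast
  ring_nf

theorem unitChar_natCast_mul (m : ℕ) (x : ℝ) : unitChar (m * x) = unitChar x ^ m := by
  rw [unitChar, unitChar, ← Complex.exp_nat_mul]
  congr 1; push_cast; ring

theorem norm_digitMean_le_one (K : ℕ) (x : ℝ) : ‖digitMean K x‖ ≤ 1 := by
  rw [digitMean, norm_div, Complex.norm_natCast]
  refine div_le_one_of_le₀ ((norm_sum_le _ _).trans ?_) (Nat.cast_nonneg _)
  simp [norm_unitChar]

theorem digitMean_add_int (K : ℕ) (x : ℝ) (n : ℤ) : digitMean K (x + n) = digitMean K x := by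
  rw [digitMean, digitMean]
  congr 1
  refine Finset.sum_congr rfl fun d _ => ?_
  rw [mul_add, unitChar_add, show (d : ℝ) * n = ((d * n : ℤ) : ℝ) by push_cast; ring,
    unitChar_intCast, mul_one]

theorem sum_unitChar_div {q : ℕ} (hq : 0 < q) {a : ℤ} (ha : |a| < q) :
    ∑ m ∈ Finset.range q, unitChar (m * (a / q)) = if a = 0 then (q : ℂ) else 0 := by
  simp_rw [unitChar_natCast_mul]
  have hq' : (q : ℝ) ≠ 0 := by positivity
  split_ifs with h
  · simp [h, unitChar_zero]
  · have hne : unitChar (a / q) ≠ 1 := fun h1 => by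
      obtain ⟨n, hn⟩ := unitChar_eq_one_iff.1 h1
      rw [div_eq_iff hq'] at hn
      have hn' : a = n * q := by exact_mod_cast hn
      have : (q : ℤ) ∣ a := ⟨n, by rw [hn']; ring⟩
      exact h (Int.eq_zero_of_abs_lt_dvd this ha)
    rw [geom_sum_eq hne, ← unitChar_natCast_mul, mul_div_cancel₀ _ hq', unitChar_intCast, sub_self,
      zero_div]

/-- Parseval on `ℤ/q`: since `K ≤ q`, distinct digits remain distinct modulo `q`, and the
off-diagonal terms cancel. -/
theorem sum_sq_norm_digitMean {K q : ℕ} (hK : 0 < K) (hKq : K ≤ q) (x : ℝ) :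
    ∑ m ∈ Finset.range q, ‖digitMean K (x + m / q)‖ ^ 2 = q / K := by
  have hq : 0 < q := hK.trans_le hKq
  have hK' : (K : ℂ) ≠ 0 := by exact_mod_cast hK.ne'
  apply Complex.ofReal_injective
  have h1 : ∀ m : ℕ, ((‖digitMean K (x + m / q)‖ ^ 2 : ℝ) : ℂ)
      = (∑ d ∈ Finset.range K, ∑ d' ∈ Finset.range K,
        unitChar ((d - d') * x) * unitChar (m * (((d - d' : ℤ) : ℝ) / q))) / K ^ 2 := fun m => by
    rw [← Complex.normSq_eq_norm_sq, Complex.normSq_eq_conj_mul_self, mul_comm, digitMean, map_div₀,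
      map_sum, div_mul_div_comm, Complex.conj_natCast, ← sq, Finset.sum_mul_sum]
    congr 1
    refine Finset.sum_congr rfl fun d _ => Finset.sum_congr rfl fun d' _ => ?_
    rw [conj_unitChar, ← unitChar_add, ← unitChar_add]
    congr 1
    push_cast
    ring
  push_cast
  simp_rw [← Complex.ofReal_pow, h1]
  rw [← Finset.sum_div, Finset.sum_comm]
  have h2 : ∀ d ∈ Finset.range K, ∑ m ∈ Finset.range q, ∑ d' ∈ Finset.range K,
      unitChar ((d - d') * x) * unitChar (m * (((d - d' : ℤ) : ℝ) / q)) = q := fun d hd => by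
    rw [Finset.sum_comm]
    have h3 : ∀ d' ∈ Finset.range K, ∑ m ∈ Finset.range q,
        unitChar ((d - d') * x) * unitChar (m * (((d - d' : ℤ) : ℝ) / q))
          = if d = d' then (q : ℂ) else 0 := fun d' hd' => by
      rw [Finset.mem_range] at hd hd'
      rw [← Finset.mul_sum, sum_unitChar_div hq (by rw [abs_lt]; omega)]
      by_cases h : d = d'
      · simp [h, unitChar_zero]
      · simp [h, sub_eq_zero]
    rw [Finset.sum_congr rfl h3, Finset.sum_ite_eq, if_pos hd]
  rw [Finset.sum_congr rfl h2, Finset.sum_const, Finset.card_range, nsmul_eq_mul]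
  field_simp

/-- For `δ ≤ 1` the extremal family is `1, δ`. If some `a j ≥ δ`, the other terms are merged into `1
+ δ - a j` and convexity on `[δ, 1]` applies; if all are below `δ`, then `a i ^ s ≤ a i * δ ^ (s -
1)`. The crude bound `1 + δ` would not do: with `δ = 4 / (i + 1)` the product diverges. -/
theorem sum_rpow_le_one_add_rpow {ι : Type*} {t : Finset ι} {a : ι → ℝ} {δ s : ℝ} (hδ : 0 ≤ δ)
    (hs : 1 ≤ s) (h0 : ∀ i ∈ t, 0 ≤ a i) (h1 : ∀ i ∈ t, a i ≤ 1) (hsum : ∑ i ∈ t, a i = 1 + δ) :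
    ∑ i ∈ t, a i ^ s ≤ 1 + δ ^ s := by
  classical
  have hs0 : 0 < s := by linarith
  obtain hδ1 | hδ1 := le_or_gt 1 δ
  · calc ∑ i ∈ t, a i ^ s ≤ ∑ i ∈ t, a i := Finset.sum_le_sum fun i hi =>
          Real.rpow_le_self_of_le_one (h0 i hi) (h1 i hi) hs
      _ ≤ 1 + δ ^ s := by rw [hsum]; gcongr; exact Real.self_le_rpow_of_one_le hδ1 hs
  by_cases hex : ∃ j ∈ t, δ ≤ a j
  · obtain ⟨j, hj, hδj⟩ := hex
    have hrest : ∑ i ∈ t.erase j, a i = 1 + δ - a j := by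
      rw [← hsum, ← Finset.add_sum_erase t a hj]; ring
    have hle : ∑ i ∈ t.erase j, a i ^ s ≤ (1 + δ - a j) ^ s := by
      rw [← hrest]
      have hnn : ∀ i ∈ t.erase j, 0 ≤ a i := fun i hi => h0 i (Finset.mem_of_mem_erase hi)
      set T := ∑ i ∈ t.erase j, a i
      have hT : 0 ≤ T := Finset.sum_nonneg hnn
      have hsp : ∀ y : ℝ, 0 ≤ y → y ^ s = y * y ^ (s - 1) := fun y hy => by
        rw [← Real.rpow_one_add' hy (by linarith)]; ring_nf
      calc ∑ i ∈ t.erase j, a i ^ s ≤ ∑ i ∈ t.erase j, a i * T ^ (s - 1) :=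
            Finset.sum_le_sum fun i hi => by
              rw [hsp _ (hnn i hi)]
              have := Finset.single_le_sum hnn hi
              have := hnn i hi
              gcongr
        _ = T ^ s := by rw [← Finset.sum_mul, ← hsp T hT]
    rw [← Finset.add_sum_erase t _ hj]
    refine (add_le_add_right hle _).trans ?_
    have hconv := convexOn_rpow hs
    have hpos : 0 < 1 - δ := by linarith
    set l := (a j - δ) / (1 - δ) with hl
    have hl0 : 0 ≤ l := div_nonneg (by linarith) hpos.le
    have hl1 : l ≤ 1 := div_le_one_of_le₀ (by linarith [h1 j hj]) hpos.le
    have hlm : l * (1 - δ) = a j - δ := by rw [hl]; field_simp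
    have c1 := hconv.2 (x := 1) (y := δ) (by simp) hδ hl0 (by linarith : 0 ≤ 1 - l) (by ring)
    have c2 := hconv.2 (x := δ) (y := 1) hδ (by simp) hl0 (by linarith : 0 ≤ 1 - l) (by ring)
    simp only [smul_eq_mul, Real.one_rpow] at c1 c2
    rw [show l * 1 + (1 - l) * δ = a j by linear_combination hlm] at c1
    rw [show l * δ + (1 - l) * 1 = 1 + δ - a j by linear_combination -hlm] at c2
    linarith
  · push Not at hex
    have hsp : ∀ y : ℝ, 0 ≤ y → y ^ s = y * y ^ (s - 1) := fun y hy => by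
      rw [← Real.rpow_one_add' hy (by linarith)]; ring_nf
    calc ∑ i ∈ t, a i ^ s ≤ ∑ i ∈ t, a i * δ ^ (s - 1) := Finset.sum_le_sum fun i hi => by
          rw [hsp _ (h0 i hi)]
          have := h0 i hi
          have := hex i hi
          gcongr
      _ = δ ^ (s - 1) + δ ^ s := by rw [← Finset.sum_mul, hsum, hsp δ hδ]; ring
      _ ≤ 1 + δ ^ s := by
          gcongr
          exact Real.rpow_le_one hδ hδ1.le (by linarith)

theorem sum_rpow_norm_digitMean_le {K q : ℕ} (hK : 0 < K) (hKq : K ≤ q) (x : ℝ) {p : ℝ}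
    (hp : 2 ≤ p) :
    ∑ m ∈ Finset.range q, ‖digitMean K (x + m / q)‖ ^ p ≤ 1 + (q / K - 1 : ℝ) ^ (p / 2) := by
  have hK' : (0 : ℝ) < K := by exact_mod_cast hK
  have hδ : (0 : ℝ) ≤ q / K - 1 := by
    rw [sub_nonneg, one_le_div hK']; exact_mod_cast hKq
  have := sum_rpow_le_one_add_rpow (t := Finset.range q)
    (a := fun m : ℕ => ‖digitMean K (x + m / q)‖ ^ 2) hδ (by linarith : 1 ≤ p / 2)
    (fun _ _ => by positivity) (fun _ _ => pow_le_one₀ (norm_nonneg _) (norm_digitMean_le_one _ _))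
    (by rw [sum_sq_norm_digitMean hK hKq]; ring)
  refine le_of_eq_of_le (Finset.sum_congr rfl fun m _ => ?_) this
  rw [← Real.rpow_natCast, ← Real.rpow_mul (norm_nonneg _)]
  congr 1; push_cast; ring

/-- The number of cells of generation `j` in the Cantor construction. -/
def cantorDenom (j : ℕ) : ℕ := ∏ i ∈ Finset.range j, (i + 5)

theorem cantorDenom_succ (j : ℕ) : cantorDenom (j + 1) = cantorDenom j * (j + 5) :=
  Finset.prod_range_succ _ _

theorem cantorDenom_pos (j : ℕ) : 0 < cantorDenom j := Finset.prod_pos fun _ _ => by omega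

theorem cantorDenom_dvd {i j : ℕ} (h : i ≤ j) : cantorDenom i ∣ cantorDenom j :=
  Finset.prod_dvd_prod_of_subset _ _ _ (Finset.range_mono h)

theorem sum_range_mul_eq {M : Type*} [AddCommMonoid M] (f : ℕ → M) (N q : ℕ) :
    ∑ n ∈ Finset.range (N * q), f n
      = ∑ n ∈ Finset.range N, ∑ m ∈ Finset.range q, f (n + N * m) := by
  rw [Finset.sum_comm]
  induction q with
  | zero => simp
  | succ q ih =>
    rw [Nat.mul_succ, Finset.sum_range_add, ih, Finset.sum_range_succ]
    simp_rw [add_comm]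

/-- Indices are written `n + N_J m`. The first `J` factors have period `N_J` and ignore `m`; the sum
over `m` of the last factor is the one-digit bound with `δ = (J+5)/(J+1) - 1`. -/
theorem sum_prod_rpow_digitMean_le {p : ℝ} (hp : 2 ≤ p) (J : ℕ) :
    ∑ n ∈ Finset.range (cantorDenom J),
        ∏ i ∈ Finset.range J, ‖digitMean (i + 1) (n / cantorDenom (i + 1))‖ ^ p
      ≤ ∏ i ∈ Finset.range J, (1 + (4 / (i + 1) : ℝ) ^ (p / 2)) := by
  induction J with
  | zero => simp [cantorDenom]
  | succ J ih =>
    rw [cantorDenom_succ, sum_range_mul_eq]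
    have hN : (cantorDenom J : ℝ) ≠ 0 := by exact_mod_cast (cantorDenom_pos J).ne'
    have hper : ∀ n m : ℕ, ∏ i ∈ Finset.range J,
        ‖digitMean (i + 1) ((n + cantorDenom J * m : ℕ) / cantorDenom (i + 1))‖ ^ p
        = ∏ i ∈ Finset.range J, ‖digitMean (i + 1) (n / cantorDenom (i + 1))‖ ^ p := fun n m => by
      refine Finset.prod_congr rfl fun i hi => ?_
      obtain ⟨c, hc⟩ := cantorDenom_dvd (Nat.succ_le_of_lt (Finset.mem_range.1 hi))
      have hNi : (cantorDenom (i + 1) : ℝ) ≠ 0 := by exact_mod_cast (cantorDenom_pos (i + 1)).ne'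
      have : ((n + cantorDenom J * m : ℕ) : ℝ) / cantorDenom (i + 1)
          = n / cantorDenom (i + 1) + ((c * m : ℤ) : ℝ) := by
        rw [hc]; push_cast; field_simp
      rw [this, digitMean_add_int]
    have hlast : ∀ n : ℕ, ∑ m ∈ Finset.range (J + 5),
        ‖digitMean (J + 1) ((n + cantorDenom J * m : ℕ) / cantorDenom (J + 1))‖ ^ p
        ≤ 1 + (4 / (J + 1) : ℝ) ^ (p / 2) := fun n => by
      have h1 := sum_rpow_norm_digitMean_le (K := J + 1) (q := J + 5) (by omega) (by omega)
        (n / cantorDenom (J + 1)) hp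
      have e1 : (((J + 5 : ℕ) : ℝ) / ((J + 1 : ℕ) : ℝ) - 1) = 4 / (J + 1) := by
        push_cast; field_simp; ring
      rw [e1] at h1
      refine le_of_eq_of_le (Finset.sum_congr rfl fun m _ => ?_) h1
      congr 3
      rw [cantorDenom_succ]
      push_cast
      field_simp
    simp_rw [Finset.prod_range_succ, hper]
    simp_rw [← Finset.mul_sum]
    refine (Finset.sum_le_sum fun n _ => mul_le_mul_of_nonneg_left (hlast n)
      (Finset.prod_nonneg fun i _ => by positivity)).trans ?_
    rw [← Finset.sum_mul]
    gcongr

theorem exists_sum_prod_rpow_digitMean_le {p : ℝ} (hp : 2 < p) :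
    ∃ C : ℝ, ∀ J : ℕ, ∑ n ∈ Finset.range (cantorDenom J),
      ∏ i ∈ Finset.range J, ‖digitMean (i + 1) (n / cantorDenom (i + 1))‖ ^ p ≤ C := by
  have hs : Summable fun i : ℕ => (4 / (i + 1) : ℝ) ^ (p / 2) := by
    have h1 : Summable fun i : ℕ => 1 / (i : ℝ) ^ (p / 2) :=
      Real.summable_one_div_nat_rpow.2 (by linarith)
    have h2 := ((summable_nat_add_iff 1).2 h1).mul_left ((4 : ℝ) ^ (p / 2))
    refine h2.congr fun i => ?_
    rw [Real.div_rpow (by norm_num) (by positivity)]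
    push_cast; ring
  refine ⟨Real.exp (∑' i : ℕ, (4 / (i + 1) : ℝ) ^ (p / 2)), fun J => ?_⟩
  refine (sum_prod_rpow_digitMean_le hp.le J).trans ?_
  calc ∏ i ∈ Finset.range J, (1 + (4 / (i + 1) : ℝ) ^ (p / 2))
      ≤ ∏ i ∈ Finset.range J, Real.exp ((4 / (i + 1) : ℝ) ^ (p / 2)) :=
        Finset.prod_le_prod (fun i _ => by positivity) fun i _ => by
          rw [add_comm]; exact Real.add_one_le_exp _
    _ = Real.exp (∑ i ∈ Finset.range J, (4 / (i + 1) : ℝ) ^ (p / 2)) := (Real.exp_sum _ _).symm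
    _ ≤ _ := Real.exp_le_exp.2 (hs.sum_le_tsum _ fun i _ => by positivity)

/-! ### The Cantor set and the length of its neighbourhoods. -/

/-- Sequences of digits; the `i`-th digit takes the `i + 1` values `0, …, i`. -/
abbrev CantorDigits : Type := (i : ℕ) → Fin (i + 1)

/-- The `i`-th term of the Cantor series. -/
noncomputable def cantorTerm (i : ℕ) (d : CantorDigits) : ℝ :=
  ((d i : ℕ) : ℝ) * (2 * π / cantorDenom (i + 1))

/-- The sum of the Cantor series. -/
noncomputable def cantorPoint (d : CantorDigits) : ℝ := ∑' i, cantorTerm i d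

theorem cantorTerm_nonneg (i : ℕ) (d : CantorDigits) : 0 ≤ cantorTerm i d := by
  have := Real.pi_pos
  unfold cantorTerm; positivity

theorem cantorTerm_le (i : ℕ) (d : CantorDigits) :
    cantorTerm i d ≤ 2 * π / cantorDenom i - 2 * π / cantorDenom (i + 1) := by
  have h1 : ((d i : ℕ) : ℝ) ≤ i := by exact_mod_cast Nat.lt_succ_iff.1 (d i).2
  have hN : (0 : ℝ) < cantorDenom i := by exact_mod_cast cantorDenom_pos i
  have hpi := Real.pi_pos
  have h2 : 2 * π / cantorDenom i - 2 * π / cantorDenom (i + 1)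
      = (i + 4) * (2 * π / cantorDenom (i + 1)) := by
    rw [cantorDenom_succ]; push_cast; field_simp; ring
  rw [h2, cantorTerm]
  gcongr
  linarith

theorem sum_cantorTerm_le (J n : ℕ) (d : CantorDigits) :
    ∑ i ∈ Finset.range n, cantorTerm (i + J) d ≤ 2 * π / cantorDenom J := by
  have h1 : ∑ i ∈ Finset.range n, cantorTerm (i + J) d
      ≤ 2 * π / cantorDenom J - 2 * π / cantorDenom (n + J) := by
    induction n with
    | zero => simp
    | succ n ih =>
      rw [Finset.sum_range_succ]
      have := cantorTerm_le (n + J) d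
      rw [show n + 1 + J = n + J + 1 by ring]
      linarith
  have hpi := Real.pi_pos
  have : 0 ≤ 2 * π / cantorDenom (n + J) := by positivity
  linarith

theorem summable_cantorTerm (d : CantorDigits) : Summable fun i => cantorTerm i d :=
  summable_of_sum_range_le (fun i => cantorTerm_nonneg i d)
    fun n => by simpa using sum_cantorTerm_le 0 n d

theorem abs_cantorPoint_sub_le (J : ℕ) (d : CantorDigits) :
    |cantorPoint d - ∑ i ∈ Finset.range J, cantorTerm i d| ≤ 2 * π / cantorDenom J := by
  rw [cantorPoint, ← (summable_cantorTerm d).sum_add_tsum_nat_add J, add_sub_cancel_left,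
    abs_of_nonneg (tsum_nonneg fun i => cantorTerm_nonneg _ d)]
  exact Real.tsum_le_of_sum_range_le (fun i => cantorTerm_nonneg _ d)
    fun n => sum_cantorTerm_le J n d

theorem continuous_cantorTerm (i : ℕ) : Continuous (cantorTerm i) :=
  ((continuous_of_discreteTopology (f := fun k : Fin (i + 1) => ((k : ℕ) : ℝ))).comp
    (continuous_apply i)).mul continuous_const

theorem continuous_cantorPoint : Continuous cantorPoint := by
  refine continuous_tsum continuous_cantorTerm
    (summable_cantorTerm fun i => Fin.last i) fun i d => ?_
  rw [Real.norm_of_nonneg (cantorTerm_nonneg i d), cantorTerm, cantorTerm]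
  have hpi := Real.pi_pos
  gcongr
  exact Nat.lt_succ_iff.1 (d i).2

/-- The Cantor set on the circle. -/
def cantorSetCircle : Set UnitCircle := Set.range fun d : CantorDigits => (cantorPoint d : UnitCircle)

theorem continuous_coe_cantorPoint :
    Continuous fun d : CantorDigits => (cantorPoint d : UnitCircle) :=
  (AddCircle.continuous_mk' _).comp continuous_cantorPoint

theorem isClosed_cantorSetCircle : IsClosed cantorSetCircle :=
  (isCompact_range continuous_coe_cantorPoint).isClosed

theorem nonempty_cantorSetCircle : cantorSetCircle.Nonempty := Set.range_nonempty _

/-- One closed ball for each of the `J!` choices of the first `J` digits covers the neighbourhood.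
-/
theorem volume_thickening_cantorSetCircle_le (J : ℕ) {ε : ℝ} (hε : 0 < ε) :
    volume.real (Metric.thickening ε cantorSetCircle)
      ≤ J.factorial * (2 * (2 * π / cantorDenom J + ε)) := by
  classical
  let ext : ((i : Fin J) → Fin (i + 1)) → CantorDigits := fun a i =>
    if h : i < J then a ⟨i, h⟩ else 0
  let c : ((i : Fin J) → Fin (i + 1)) → UnitCircle := fun a =>
    ((∑ i ∈ Finset.range J, cantorTerm i (ext a) : ℝ) : UnitCircle)
  set r : ℝ := 2 * π / cantorDenom J + ε
  have hpi := Real.pi_pos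
  have hr : 0 < r := by positivity
  have hsub : Metric.thickening ε cantorSetCircle
      ⊆ ⋃ a ∈ (Finset.univ : Finset ((i : Fin J) → Fin (i + 1))), Metric.closedBall (c a) r := by
    intro θ hθ
    obtain ⟨_, ⟨d, rfl⟩, hd⟩ := Metric.mem_thickening_iff.1 hθ
    refine Set.mem_iUnion₂.2 ⟨fun i => d i, Finset.mem_univ _, ?_⟩
    have hc : c (fun i => d i) = ((∑ i ∈ Finset.range J, cantorTerm i d : ℝ) : UnitCircle) := by
      simp only [c]
      congr 1
      refine Finset.sum_congr rfl fun i hi => ?_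
      simp [cantorTerm, ext, Finset.mem_range.1 hi]
    rw [Metric.mem_closedBall, hc]
    suffices h : dist (cantorPoint d : UnitCircle)
        ((∑ i ∈ Finset.range J, cantorTerm i d : ℝ) : UnitCircle) ≤ 2 * π / cantorDenom J from
      (dist_triangle _ _ _).trans ((add_le_add hd.le h).trans_eq (add_comm _ _))
    rw [dist_eq_norm, ← AddCircle.coe_sub]
    refine le_trans ?_ (abs_cantorPoint_sub_le J d)
    obtain h | h := le_or_gt |cantorPoint d - ∑ i ∈ Finset.range J, cantorTerm i d| π
    · refine ((AddCircle.norm_coe_eq_abs_iff _ Real.two_pi_pos.ne').2 ?_).le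
      rw [abs_of_pos Real.two_pi_pos]; linarith
    · refine (AddCircle.norm_le_half_period _ Real.two_pi_pos.ne').trans ?_
      rw [abs_of_pos Real.two_pi_pos]; linarith
  refine (measureReal_mono hsub (measure_ne_top _ _)).trans ((measureReal_biUnion_finset_le _ _).trans ?_)
  have hball : ∀ x : UnitCircle, volume.real (Metric.closedBall x r) ≤ 2 * r := fun x => by
    rw [measureReal_def, AddCircle.volume_closedBall, ENNReal.toReal_ofReal (by positivity)]
    exact min_le_right _ _
  refine (Finset.sum_le_sum fun a _ => hball (c a)).trans_eq ?_
  rw [Finset.sum_const, nsmul_eq_mul]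
  congr 2
  rw [Finset.card_univ, Fintype.card_pi]
  simp only [Fintype.card_fin]
  rw [Fin.prod_univ_eq_prod_range (fun i => i + 1), Finset.prod_range_add_one_eq_factorial]

theorem cantorDenom_le (J : ℕ) : cantorDenom J ≤ 3 * 2 ^ (J ^ 2) := by
  -- The induction starts at `1`: from `0` to `1` the bound only doubles, while the denominator
  -- grows by a factor `5`.
  rcases J with _ | J
  · simp [cantorDenom]
  induction J with
  | zero => simp [cantorDenom]
  | succ J ih =>
    rw [cantorDenom_succ]
    have h1 : J + 1 + 5 ≤ 2 ^ (2 * J + 3) := by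
      have h2 : J < 2 ^ J := Nat.lt_two_pow_self
      have h3 : 2 ^ J ≤ 2 ^ (2 * J) := Nat.pow_le_pow_right (by norm_num) (by omega)
      rw [pow_add]; omega
    calc cantorDenom (J + 1) * (J + 1 + 5) ≤ (3 * 2 ^ ((J + 1) ^ 2)) * 2 ^ (2 * J + 3) :=
          Nat.mul_le_mul ih h1
      _ = 3 * 2 ^ ((J + 1 + 1) ^ 2) := by rw [mul_assoc, ← pow_add]; congr 2; ring

/-- Here `N_J = (J + 4)! / 4!`. -/
theorem factorial_mul_le_cantorDenom (J : ℕ) : J.factorial * (J + 1) ^ 4 ≤ 24 * cantorDenom J := by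
  have h : ∀ J : ℕ, J.factorial * ((J + 1) * (J + 2) * (J + 3) * (J + 4)) = 24 * cantorDenom J := by
    intro J
    induction J with
    | zero => simp [cantorDenom]
    | succ J ih =>
      rw [cantorDenom_succ, Nat.factorial_succ]; linear_combination (J + 5) * ih
  rw [← h]
  gcongr
  calc (J + 1) ^ 4 = (J + 1) * (J + 1) * (J + 1) * (J + 1) := by ring
    _ ≤ _ := by gcongr <;> omega

theorem summable_thickening_cantorSetCircle :
    Summable fun k : ℕ => volume.real (Metric.thickening ((1 / 2) ^ k) cantorSetCircle) := by
  have h1 : Summable fun k : ℕ => 1 / (k : ℝ) ^ 2 := Real.summable_one_div_nat_pow.2 one_lt_two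
  have h2 := ((summable_nat_add_iff 1).2 h1).mul_left (48 * (2 * π + 3))
  refine h2.of_nonneg_of_le (fun _ => measureReal_nonneg) fun k => ?_
  -- With `J ≈ √k`, the width `2⁻ᵏ` is at most `3 / N_J`, and `J! / N_J ≲ J⁻⁴` becomes `k⁻²`.
  set J := Nat.sqrt k
  have hpi := Real.pi_pos
  refine (volume_thickening_cantorSetCircle_le J (by positivity)).trans ?_
  have hN : (0 : ℝ) < cantorDenom J := by exact_mod_cast cantorDenom_pos J
  have hJk : J ^ 2 ≤ k := Nat.sqrt_le' k
  have hε : (1 / 2 : ℝ) ^ k ≤ 3 / cantorDenom J := by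
    rw [le_div_iff₀ hN, one_div, inv_pow, inv_mul_le_iff₀ (by positivity)]
    have : cantorDenom J ≤ 2 ^ k * 3 := (cantorDenom_le J).trans (by
      rw [mul_comm]; exact Nat.mul_le_mul_right _ (Nat.pow_le_pow_right (by norm_num) hJk))
    exact_mod_cast this
  have hfac : (J.factorial : ℝ) * (J + 1) ^ 4 ≤ 24 * cantorDenom J := by
    exact_mod_cast factorial_mul_le_cantorDenom J
  have hk1 : ((k + 1 : ℕ) : ℝ) ≤ (J + 1) ^ 2 := by
    have : k + 1 ≤ (J + 1) ^ 2 := Nat.lt_succ_sqrt' k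
    exact_mod_cast this
  have hk0 : (0 : ℝ) < ((k + 1 : ℕ) : ℝ) := by positivity
  have hfac2 : (J.factorial : ℝ) / cantorDenom J ≤ 24 / ((k + 1 : ℕ) : ℝ) ^ 2 := by
    rw [div_le_div_iff₀ hN (by positivity)]
    refine le_trans ?_ hfac
    gcongr
    calc ((k + 1 : ℕ) : ℝ) ^ 2 ≤ ((J + 1) ^ 2) ^ 2 := by gcongr
      _ = _ := by ring
  calc (J.factorial : ℝ) * (2 * (2 * π / cantorDenom J + (1 / 2) ^ k))
      ≤ J.factorial * (2 * (2 * π / cantorDenom J + 3 / cantorDenom J)) := by gcongr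
    _ = (J.factorial / cantorDenom J) * (2 * (2 * π + 3)) := by field_simp
    _ ≤ (24 / ((k + 1 : ℕ) : ℝ) ^ 2) * (2 * (2 * π + 3)) := by gcongr
    _ = _ := by ring

/-! ### The Cantor measure and its Fourier coefficients. -/

/-- The uniform distribution of the digits. -/
noncomputable def digitsMeasure : Measure CantorDigits :=
  Measure.infinitePi fun i => (PMF.uniformOfFintype (Fin (i + 1))).toMeasure

instance : IsProbabilityMeasure digitsMeasure := by unfold digitsMeasure; infer_instance

/-- The Cantor measure on the circle. -/
noncomputable def cantorMeasureCircle : Measure UnitCircle :=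
  digitsMeasure.map fun d => (cantorPoint d : UnitCircle)

instance : IsProbabilityMeasure cantorMeasureCircle :=
  Measure.isProbabilityMeasure_map continuous_coe_cantorPoint.measurable.aemeasurable

theorem cantorMeasureCircle_compl : cantorMeasureCircle cantorSetCircleᶜ = 0 := by
  rw [cantorMeasureCircle, Measure.map_apply continuous_coe_cantorPoint.measurable
    isClosed_cantorSetCircle.measurableSet.compl]
  convert measure_empty (μ := digitsMeasure)
  ext d
  simp [cantorSetCircle]

theorem fourier_coe_eq_unitChar (n : ℤ) (x : ℝ) :
    fourier (-n) (x : UnitCircle) = unitChar (n * (x / (2 * π))) := by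
  rw [fourier_coe_apply, unitChar]
  congr 1
  have hpi : (π : ℂ) ≠ 0 := Complex.ofReal_ne_zero.2 Real.pi_ne_zero
  push_cast
  field_simp

theorem unitChar_sum {ι : Type*} (s : Finset ι) (f : ι → ℝ) :
    unitChar (∑ i ∈ s, f i) = ∏ i ∈ s, unitChar (f i) := by
  classical
  induction s using Finset.induction_on with
  | empty => simp [unitChar_zero]
  | insert a s ha ih => rw [Finset.sum_insert ha, Finset.prod_insert ha, unitChar_add, ih]

theorem continuous_unitChar : Continuous unitChar := by
  unfold unitChar; fun_prop

theorem integral_unitChar_sum_cantorTerm (n : ℤ) (J : ℕ) :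
    ∫ d, unitChar (n * ((∑ i ∈ Finset.range J, cantorTerm i d) / (2 * π))) ∂digitsMeasure
      = ∏ i ∈ Finset.range J, digitMean (i + 1) (n / cantorDenom (i + 1)) := by
  have h1 : ∀ d : CantorDigits, unitChar (n * ((∑ i ∈ Finset.range J, cantorTerm i d) / (2 * π)))
      = ∏ i : Finset.range J, unitChar (((d i : ℕ) : ℝ) * (n / cantorDenom (i + 1))) := fun d => by
    rw [Finset.prod_coe_sort (Finset.range J)
      (fun i => unitChar (((d i : ℕ) : ℝ) * (n / cantorDenom (i + 1)))), ← unitChar_sum]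
    congr 1
    rw [Finset.sum_div, Finset.mul_sum]
    refine Finset.sum_congr rfl fun i _ => ?_
    rw [cantorTerm]
    have := Real.pi_pos
    field_simp
  simp_rw [h1]
  have h2 := integral_restrict_infinitePi (s := Finset.range J)
    (μ := fun i => (PMF.uniformOfFintype (Fin (i + 1))).toMeasure)
    (f := fun x : (i : Finset.range J) → Fin (i + 1) =>
      ∏ i : Finset.range J, unitChar (((x i : ℕ) : ℝ) * (n / cantorDenom (i + 1))))
    (Measurable.aestronglyMeasurable (measurable_of_countable _))
  refine h2.trans ?_
  rw [integral_fintype_prod_eq_prod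
    (f := fun (i : Finset.range J) (k : Fin (i + 1)) =>
      unitChar (((k : ℕ) : ℝ) * (n / cantorDenom (i + 1)))),
    ← Finset.prod_coe_sort (Finset.range J)]
  refine Finset.prod_congr rfl fun i _ => ?_
  rw [PMF.integral_eq_sum, digitMean, ← Fin.sum_univ_eq_sum_range
    (fun k => unitChar ((k : ℝ) * (n / cantorDenom (i + 1))))]
  simp only [PMF.uniformOfFintype_apply, Fintype.card_fin, ENNReal.toReal_inv,
    ENNReal.toReal_natCast, Complex.real_smul, ← Finset.mul_sum, div_eq_inv_mul]
  push_cast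
  rfl

/-- By independence of the digits the coefficient is a limit of partial products. All factors have
modulus at most `1`, so any partial product is an upper bound. -/
theorem norm_measureFourierCoeff_cantor_le (n : ℤ) (J : ℕ) :
    ‖measureFourierCoeff cantorMeasureCircle n‖
      ≤ ∏ i ∈ Finset.range J, ‖digitMean (i + 1) (n / cantorDenom (i + 1))‖ := by
  have h1 : measureFourierCoeff cantorMeasureCircle n
      = ∫ d, unitChar (n * (cantorPoint d / (2 * π))) ∂digitsMeasure := by
    rw [measureFourierCoeff, cantorMeasureCircle,
      integral_map continuous_coe_cantorPoint.measurable.aemeasurable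
        (map_continuous (fourier (-n))).aestronglyMeasurable]
    simp_rw [fourier_coe_eq_unitChar]
  have h2 : Tendsto (fun L : ℕ => ∫ d,
      unitChar (n * ((∑ i ∈ Finset.range L, cantorTerm i d) / (2 * π))) ∂digitsMeasure) atTop
      (𝓝 (measureFourierCoeff cantorMeasureCircle n)) := by
    rw [h1]
    refine tendsto_integral_of_dominated_convergence (fun _ => 1) (fun L => ?_)
      (integrable_const _) (fun L => ae_of_all _ fun d => (norm_unitChar _).le)
      (ae_of_all _ fun d => ?_)
    · refine Continuous.aestronglyMeasurable (continuous_unitChar.comp ?_)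
      exact continuous_const.mul ((continuous_finsetSum _ fun i _ =>
        continuous_cantorTerm i).div_const _)
    · exact (continuous_unitChar.tendsto _).comp
        (((summable_cantorTerm d).hasSum.tendsto_sum_nat.div_const _).const_mul _)
  simp_rw [integral_unitChar_sum_cantorTerm] at h2
  refine le_of_tendsto h2.norm ?_
  filter_upwards [eventually_ge_atTop J] with L hL
  rw [norm_prod]
  exact Finset.prod_le_prod_of_subset_of_le_one (Finset.range_mono hL)
    (fun i _ => norm_nonneg _) fun i _ _ => norm_digitMean_le_one _ _

theorem summable_measureFourierCoeff_cantor {p : ℝ} (hp : 2 < p) :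
    Summable fun n : ℤ => ‖measureFourierCoeff cantorMeasureCircle n‖ ^ p := by
  obtain ⟨C, hC⟩ := exists_sum_prod_rpow_digitMean_le hp
  have hnat : Summable fun n : ℕ => ‖measureFourierCoeff cantorMeasureCircle n‖ ^ p := by
    refine summable_of_sum_range_le (c := C) (fun _ => by positivity) fun M => ?_
    -- This places the first `M` indices inside the full period over which the product bound is
    -- summed.
    have hM : M ≤ cantorDenom M := by
      have h1 : M < 5 ^ M := Nat.lt_pow_self (by norm_num)
      have h2 : 5 ^ M ≤ cantorDenom M := by
        rw [cantorDenom, ← Finset.card_range M, ← Finset.prod_const, Finset.card_range]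
        exact Finset.prod_le_prod' fun i _ => by omega
      omega
    refine le_trans ?_ (hC M)
    refine (Finset.sum_le_sum_of_subset_of_nonneg (Finset.range_mono hM)
      fun _ _ _ => by positivity).trans (Finset.sum_le_sum fun n _ => ?_)
    rw [Real.finsetProd_rpow _ _ fun i _ => norm_nonneg _]
    gcongr
    simpa using norm_measureFourierCoeff_cantor_le n M
  refine Summable.of_nat_of_neg hnat (hnat.congr fun n => ?_)
  congr 1
  have : measureFourierCoeff cantorMeasureCircle (-(n : ℤ))
      = (starRingEnd ℂ) (measureFourierCoeff cantorMeasureCircle n) := by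
    rw [measureFourierCoeff, measureFourierCoeff, ← integral_conj]
    refine integral_congr_ae (ae_of_all _ fun θ => ?_)
    simp only [fourier_neg, Complex.conj_conj, neg_neg]
  rw [this, RCLike.norm_conj]

/-! ### The logarithm of `S`, and the conclusion. -/

theorem hasSum_herglotz_planeMeasure (μ : Measure UnitCircle) [IsFiniteMeasure μ] {z : ℂ}
    (hz : ‖z‖ < 1) :
    HasSum (fun k : ℕ => (if k = 0 then (μ.real Set.univ : ℂ) else 2 * measureFourierCoeff μ k)
      * z ^ k) (herglotz (planeMeasure μ) z) := by
  have hH : herglotz (planeMeasure μ) z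
      = ∫ θ, ((θ.toCircle : ℂ) + z) / ((θ.toCircle : ℂ) - z) ∂μ := by
    rw [herglotz, planeMeasure, integral_map continuous_coe_toCircle.aemeasurable
      (aestronglyMeasurable_herglotz_kernel z)]
  have hfc : ∀ (n : ℕ) (θ : UnitCircle), fourier (-(n : ℤ)) θ = (θ.toCircle : ℂ)⁻¹ ^ n := fun n θ => by
    rw [fourier_apply, AddCircle.toCircle_zsmul, Circle.coe_zpow, zpow_neg, zpow_natCast, inv_pow]
  have hpt : ∀ θ : UnitCircle, HasSum (fun k : ℕ => (if k = 0 then 1 else 2) *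
      fourier (-(k : ℤ)) θ * z ^ k) (((θ.toCircle : ℂ) + z) / ((θ.toCircle : ℂ) - z)) := fun θ => by
    set w : ℂ := (θ.toCircle : ℂ) with hw
    have hw1 : ‖w‖ = 1 := norm_toCircle θ
    have hw0 : w ≠ 0 := by rw [← norm_pos_iff, hw1]; exact one_pos
    have hwz : w - z ≠ 0 := fun h => by
      rw [sub_eq_zero] at h
      rw [← h, hw1] at hz
      exact lt_irrefl _ hz
    have hx : ‖w⁻¹ * z‖ < 1 := by rw [norm_mul, norm_inv, hw1]; simpa using hz
    have h1 := ((hasSum_geometric_of_norm_lt_one hx).mul_left 2).sub (hasSum_ite_eq 0 (1 : ℂ))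
    have e1 : (w + z) / (w - z) = 2 * (1 - w⁻¹ * z)⁻¹ - 1 := by
      have h2 : 1 - w⁻¹ * z = (w - z) / w := by field_simp
      rw [h2, inv_div]
      field_simp
      ring
    rw [e1]
    refine h1.congr_fun fun k => Eq.symm ?_
    rw [hfc, ← hw, mul_pow]
    split_ifs with hk
    · simp [hk]; norm_num
    · ring
  have hint : ∀ k : ℕ, Integrable (fun θ : UnitCircle => (if k = 0 then 1 else 2) *
      fourier (-(k : ℤ)) θ * z ^ k) μ := fun k =>
    ((continuous_const.mul (map_continuous (fourier (-(k : ℤ))))).mul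
      continuous_const).integrable_of_hasCompactSupport (HasCompactSupport.of_compactSpace _)
  have key := hasSum_integral_of_summable_integral_norm hint ?_
  · rw [hH]
    have h1 : ∀ θ : UnitCircle, ∑' k : ℕ, (if k = 0 then 1 else 2) * fourier (-(k : ℤ)) θ * z ^ k
        = ((θ.toCircle : ℂ) + z) / ((θ.toCircle : ℂ) - z) := fun θ => (hpt θ).tsum_eq
    simp_rw [h1, integral_mul_const, integral_const_mul] at key
    refine key.congr_fun fun k => Eq.symm ?_
    split_ifs with hk
    · simp [hk]
    · rfl
  · refine Summable.of_nonneg_of_le (fun _ => integral_nonneg fun _ => norm_nonneg _) (fun k => ?_)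
      ((summable_geometric_of_lt_one (norm_nonneg z) hz).mul_left (2 * μ.real Set.univ))
    have hb : ∀ θ : UnitCircle, ‖(if k = 0 then 1 else 2) * fourier (-(k : ℤ)) θ * z ^ k‖
        ≤ 2 * ‖z‖ ^ k := fun θ => by
      have h1 : ‖(if k = 0 then 1 else 2 : ℂ)‖ ≤ 2 := by split_ifs <;> simp
      rw [norm_mul, norm_mul, hfc, norm_pow, norm_inv, norm_toCircle, norm_pow, inv_one, one_pow,
        mul_one]
      gcongr
    refine (integral_mono_of_nonneg (ae_of_all _ fun _ => norm_nonneg _) (integrable_const _)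
      (ae_of_all _ hb)).trans_eq ?_
    rw [integral_const, smul_eq_mul]
    ring

/-- `g + H` has exponential `1`, hence zero derivative, so it is constant; the branch affects only
the coefficient of order `0`. -/
theorem maclaurinCoeff_log_singularInner {μ : Measure UnitCircle} [IsFiniteMeasure μ] {g : ℂ → ℂ}
    (hg : IsHolomorphicLog g (singularInner μ))
    (hd : DifferentiableOn ℂ (herglotz (planeMeasure μ)) (Metric.ball 0 1)) {k : ℕ} (hk : k ≠ 0) :
    maclaurinCoeff g k = -2 * measureFourierCoeff μ k := by
  obtain ⟨hg1, hg2⟩ := hg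
  have hopen : IsOpen (Metric.ball (0 : ℂ) 1) := Metric.isOpen_ball
  set h : ℂ → ℂ := fun z => g z + herglotz (planeMeasure μ) z with hh
  have hhd : DifferentiableOn ℂ h (Metric.ball 0 1) := hg1.add hd
  have hexp : ∀ z ∈ Metric.ball (0 : ℂ) 1, Complex.exp (h z) = 1 := fun z hz => by
    rw [hh, Complex.exp_add, hg2 z hz, singularInner_eq_exp_herglotz, ← Complex.exp_add]; simp
  have hder : Set.EqOn (deriv h) 0 (Metric.ball 0 1) := fun z hz => by
    have h1 := (hhd.differentiableAt (hopen.mem_nhds hz)).hasDerivAt.cexp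
    have h2 : HasDerivAt (fun x => Complex.exp (h x)) 0 z :=
      (hasDerivAt_const z (1 : ℂ)).congr_of_eventuallyEq
        (Filter.eventually_of_mem (hopen.mem_nhds hz) hexp)
    have h3 := h1.unique h2
    exact (mul_eq_zero.1 h3).resolve_left (Complex.exp_ne_zero _)
  have hconst : ∀ z ∈ Metric.ball (0 : ℂ) 1, h z = h 0 := fun z hz =>
    hopen.is_const_of_deriv_eq_zero (convex_ball (0 : ℂ) 1).isPreconnected hhd hder hz
      (Metric.mem_ball_self one_pos)
  have hs : ∀ z : ℂ, ‖z‖ < 1 → HasSum (fun j : ℕ => ((if j = 0 then h 0 else 0) -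
      (if j = 0 then (μ.real Set.univ : ℂ) else 2 * measureFourierCoeff μ j)) * z ^ j) (g z) := by
    intro z hz
    have h1 := (hasSum_ite_eq 0 (h 0)).sub (hasSum_herglotz_planeMeasure μ hz)
    have h2 : g z = h 0 - herglotz (planeMeasure μ) z := by
      rw [← hconst z (by simpa using hz)]; simp [hh]
    rw [h2]
    refine h1.congr_fun fun j => Eq.symm ?_
    split_ifs with hj
    · simp [hj]
    · ring
  rw [maclaurinCoeff_eq_of_hasSum hs k, if_neg hk, if_neg hk]
  ring

theorem mainTheorem7 (p : ℝ) (hp : 2 < p) :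
    ∃ μ : Measure UnitCircle,
      IsFiniteMeasure μ ∧ μ ≠ 0 ∧ μ ⟂ₘ (volume : Measure UnitCircle) ∧
      (∃ E : Set UnitCircle, IsBeurlingCarleson E ∧ μ Eᶜ = 0) ∧
      (Summable fun n : ℤ => ‖measureFourierCoeff μ n‖ ^ p) ∧
      ((∃ g : ℂ → ℂ, IsHolomorphicLog g (singularInner μ)) ∧
        ∀ g : ℂ → ℂ, IsHolomorphicLog g (singularInner μ) → MemEllpA p g) ∧
      MemEllpA p (singularInner μ) ∧
      ¬ IsCyclicEllpA p (singularInner μ) := by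
  have hp0 : 0 < p := by linarith
  have hE := isClosed_cantorSetCircle
  have hE0 := nonempty_cantorSetCircle
  have hs := summable_thickening_cantorSetCircle
  have hμE := cantorMeasureCircle_compl
  have hcar := carriedNear_planeMeasure hE hμE
  have hd := hcar.differentiableOn_herglotz (isClosed_circleImage hE) (hE0.image _)
    circleImage_subset_sphere
  have hF := summable_measureFourierCoeff_cantor hp
  have hSd : DifferentiableOn ℂ (singularInner cantorMeasureCircle) (Metric.ball 0 1) := by
    rw [funext (singularInner_eq_exp_herglotz cantorMeasureCircle)]
    exact hd.neg.cexp
  have hne : cantorMeasureCircle ≠ 0 := IsProbabilityMeasure.ne_zero _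
  refine ⟨cantorMeasureCircle, inferInstance, hne, ?_,
    ⟨cantorSetCircle, isBeurlingCarleson_of_summable_thickening hE hE0 hs, hμE⟩, hF,
    ⟨⟨fun z => -herglotz (planeMeasure cantorMeasureCircle) z, hd.neg,
      fun z _ => (singularInner_eq_exp_herglotz _ z).symm⟩, fun g hg => ⟨hg.1, ?_⟩⟩,
    ⟨hSd, ?_⟩, not_isCyclicEllpA_singularInner hne hE hE0 hs hμE hp0⟩
  · exact ⟨cantorSetCircleᶜ, hE.measurableSet.compl, hμE, by
      rw [compl_compl]; exact volume_eq_zero_of_summable_thickening hs⟩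
  · refine ellpNorm_lt_top_of_summable hp0 ?_
    have h1 : Summable fun k : ℕ => ‖measureFourierCoeff cantorMeasureCircle k‖ ^ p :=
      hF.comp_injective Nat.cast_injective
    -- The coefficient of order `0` depends on the branch and is discarded.
    refine (summable_nat_add_iff 1).1
      ((((summable_nat_add_iff 1).2 h1).mul_left (2 ^ p)).congr fun k => ?_)
    rw [maclaurinCoeff_log_singularInner hg hd k.succ_ne_zero, norm_mul, norm_neg,
      Complex.norm_ofNat, Real.mul_rpow (by norm_num) (norm_nonneg _)]
  · refine ellpNorm_lt_top_of_summable hp0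
      (summable_rpow_norm_maclaurinCoeff hSd (C := 1) (fun z hz => ?_) hp.le)
    rw [singularInner_eq_exp_herglotz]
    exact norm_exp_neg_herglotz_le_one hcar hz.le
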